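/- **Setting.** Let $G$ be a finite abelian group with unit $e$, and let $\widehat G$ be its group of characters, with trivial character $\iota$. Let $\mathcal B$ be the set of edges between nearest neighbours of $\mathbb Z^2$, oriented to point right or up, and attach to each edge a copy of $\mathbb C^{|G|}$ with orthonormal basis $\{|g\rangle : g\in G\}$. For finite $\Lambda\subset\mathcal B$ put $\mathcal A_\Lambda=\bigotimes_{x\in\Lambda} M_{|G|}(\mathbb C)$, with the inclusions $A\mapsto A\otimes I$; let $\mathcal A_{loc}=\bigcup_\Lambda\mathcal A_\Lambda$ and let the quasi-local $C^*$-algebra $\mathcal A$ be its norm completion. For a vertex $v$ and $g\in G$ the star operator $A_v^g$ acts on the four edges at $v$: on basis vectors it multiplies the labels of the edges leaving $v$ by $g$ and the labels of the edges entering $v$ by $g^{-1}$. For a face (unit square) $f$ and $h\in G$ the plaquette operator $B_f^h$ acts on the four edges of $f$: it is the projection onto the span of the basis vectors whose monodromy around $f$ is $h$, the monodromy being the clockwise product of the labels, with a label inverted if its edge points counterclockwise. Put $A_v=\frac1{|G|}\sum_{g}A_v^g$ and $B_f=B_f^e$. Let $\Lambda_L$ be the set of all edges in $[-L,L]^2$,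 and let $\mathcal V_L$, $\mathcal F_L$ be the vertices, resp. faces, all four of whose edges lie in $\Lambda_L$. Define $$H_L=\sum_{v\in\mathcal V_L}(I-A_v)+\sum_{f\in\mathcal F_L}(I-B_f),\qquad \delta(A)=\lim_{L\to\infty}[H_L,A]\quad(A\in\mathcal A_{loc}).$$ The set $K$ of infinite-volume ground states consists of all states $\omega$ on $\mathcal A$ (positive normalised linear functionals) with $\omega(A^*\delta(A))\ge 0$ for all $A\in\mathcal A_{loc}$. For $\chi\in\widehat G$ and $c\in G$ put $D_v^\chi=\frac1{|G|}\sum_{g}\overline{\chi(g)}A_v^g$ and $D_f^c=B_f^c$. The global charge projectors of the box $\Lambda_L$ are $$D_L^\chi=\sum_{\prod_v\chi_v=\chi}\ \prod_{v\in\mathcal V_L}D_v^{\chi_v},\qquad D_L^c=\sum_{\prod_f c_f=c}\ \prod_{f\in\mathcal F_L}D_f^{c_f},\qquad D_L^{\chi,c}=D_L^\chi D_L^c,$$ the sums being over all configurations $(\chi_v)_{v\in\mathcal V_L}$ in $\widehat G$, resp. $(c_f)_{f\in\mathcal F_L}$ in $G$, with the indicated product. For $(\chi,c)\in\widehat G\times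 G$ let $K^{\chi,c}$ be the set of all states $\phi$ on $\mathcal A$ for which there is an $\omega\in K$ such that $\lim_{L\to\infty}\omega(D_L^{\chi,c})$ exists and is positive and $$\phi=\mathrm{w}^*\text{-}\lim_{L\to\infty}\frac{\omega(\,\cdot\,D_L^{\chi,c})}{\omega(D_L^{\chi,c})}.$$ **Theorem (ground state decomposition).** Let $\omega\in K$. Then for every $(\chi,c)\in\widehat G\times G$ the limit $$\lambda_{\chi,c}(\omega)=\lim_{L\to\infty}\omega(D_L^{\chi,c})$$ exists, $\lambda_{\chi,c}(\omega)\ge 0$, $\sum_{\chi,c}\lambda_{\chi,c}(\omega)=1$, and there are $\omega^{\chi,c}\in K^{\chi,c}$, for all $(\chi,c)\in\widehat G\times G$, such that $$\omega=\sum_{\chi\in\widehat G,\,c\in G}\lambda_{\chi,c}(\omega)\,\omega^{\chi,c},$$ and such that, whenever $\lambda_{\chi,c}(\omega)>0$, $$\omega^{\chi,c}=\mathrm{w}^*\text{-}\lim_{L\to\infty}\frac{\omega(\,\cdot\,D_L^{\chi,c})}{\omega(D_L^{\chi,c})}.$$ -/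

import Mathlib

set_option linter.unusedSectionVars false

open Filter Topology
open scoped ENNReal ComplexOrder

noncomputable section

namespace QuantumDouble

/-! ### The lattice -/

/-- The bonds of `ℤ²`: `(v, false)` is the edge from `v` to its right neighbour `v + (1,0)` and
`(v, true)` is the edge from `v` to its upper neighbour `v + (0,1)`; edges point right or up. -/
abbrev Edge : Type := (ℤ × ℤ) × Bool

/-- The initial vertex of an edge. -/
def Edge.src (e : Edge) : ℤ × ℤ := e.1

/-- The terminal vertex of an edge. -/
def Edge.tgt (e : Edge) : ℤ × ℤ := if e.2 then e.1 + (0, 1) else e.1 + (1, 0)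

/-- The star of a vertex: the four edges that have `v` as an end point. -/
def star4 (v : ℤ × ℤ) : Finset Edge :=
  {(v, false), (v, true), (v - (1, 0), false), (v - (0, 1), true)}

/-- The plaquette whose lower left corner is `f`: left, top, right and bottom edge of the unit
square with corners `f` and `f + (1,1)`. -/
def plaq4 (f : ℤ × ℤ) : Finset Edge :=
  {(f, true), (f + (0, 1), false), (f + (1, 0), true), (f, false)}

/-- The vertices in `[-L, L]²`. -/
def vertexBox (L : ℕ) : Finset (ℤ × ℤ) := Finset.Icc (-(L : ℤ), -(L : ℤ)) ((L : ℤ), (L : ℤ))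

/-- `Λ_L`: all the edges in `[-L, L]²`. -/
def edgeBox (L : ℕ) : Finset Edge :=
  (vertexBox L ×ˢ Finset.univ).filter (fun e => Edge.tgt e ∈ vertexBox L)

/-- The (centres of the) stars contained in `Λ_L`. -/
def starsIn (L : ℕ) : Finset (ℤ × ℤ) := (vertexBox L).filter (fun v => star4 v ⊆ edgeBox L)

/-- The (lower left corners of the) plaquettes contained in `Λ_L`. -/
def plaqsIn (L : ℕ) : Finset (ℤ × ℤ) := (vertexBox L).filter (fun f => plaq4 f ⊆ edgeBox L)

section Algebra

variable (G : Type*)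

/-- `G`-connections on the whole lattice. -/
abbrev Config : Type _ := Edge → G

/-- The Hilbert space `ℓ²(G^𝓑)`. It only serves to realise the quasi-local algebra as an algebra
of operators: every finite set `Λ` of edges gives a faithful (hence isometric) representation
`localOp Λ` of `𝒜_Λ` on it, and these are compatible with the inclusions `A ↦ A ⊗ I`. -/
abbrev Hilb : Type _ := lp (fun _ : Config G => ℂ) 2

variable {G}

/-- `glue Λ c a` agrees with `a` on `Λ` and with `c` outside `Λ`. -/
def glue (Λ : Finset Edge) (c : Config G) (a : Λ → G) : Config G :=
  fun e => if h : e ∈ Λ then a ⟨e, h⟩ else c e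

lemma restrict_glue (Λ : Finset Edge) (c : Config G) (a : Λ → G) :
    Λ.restrict (glue Λ c a) = a := by
  funext e
  simp [glue]

lemma glue_glue (Λ : Finset Edge) (c : Config G) (a b : Λ → G) :
    glue Λ (glue Λ c a) b = glue Λ c b := by
  funext e
  by_cases h : e ∈ Λ <;> simp [glue, h]

lemma glue_restrict (Λ : Finset Edge) (c : Config G) : glue Λ c (Λ.restrict c) = c := by
  funext e
  by_cases h : e ∈ Λ <;> simp [glue, h]

lemma memlp_weighted (k : Config G → ℂ) (σ : Equiv.Perm (Config G)) {C : ℝ}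
    (hk : ∀ c, ‖k c‖ ≤ C) (ψ : Hilb G) : Memℓp (fun c => k c * ψ (σ c)) 2 := by
  have h2 : (0 : ℝ) < (2 : ℝ≥0∞).toReal := by norm_num
  rw [memℓp_gen_iff h2]
  have hs : Summable fun c => ‖ψ c‖ ^ (2 : ℝ≥0∞).toReal := (memℓp_gen_iff h2).1 (lp.memℓp ψ)
  have hs' : Summable fun c => C ^ (2 : ℝ≥0∞).toReal * ‖ψ (σ c)‖ ^ (2 : ℝ≥0∞).toReal :=
    (hs.comp_injective σ.injective).mul_left _
  refine Summable.of_nonneg_of_le (fun c => by positivity) (fun c => ?_) hs'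
  have hC : 0 ≤ C := (norm_nonneg _).trans (hk c)
  rw [norm_mul, Real.mul_rpow (norm_nonneg _) (norm_nonneg _)]
  gcongr
  exact hk c

/-- The bounded operator `(weighted k σ ψ)(c) = k(c) ψ(σ c)`. -/
def weighted (k : Config G → ℂ) (σ : Equiv.Perm (Config G)) (C : ℝ)
    (hk : ∀ c, ‖k c‖ ≤ C) : Hilb G →L[ℂ] Hilb G :=
  LinearMap.mkContinuous
    { toFun := fun ψ => ⟨fun c => k c * ψ (σ c), memlp_weighted k σ hk ψ⟩
      map_add' := fun ψ φ => by
        ext c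
        change k c * (ψ + φ : Hilb G) (σ c) = k c * ψ (σ c) + k c * φ (σ c)
        rw [lp.coeFn_add, Pi.add_apply, mul_add]
      map_smul' := fun z ψ => by
        ext c
        change k c * (z • ψ : Hilb G) (σ c) = z * (k c * ψ (σ c))
        rw [lp.coeFn_smul, Pi.smul_apply, smul_eq_mul]
        ring }
    |C| (fun ψ => by
      have h2 : (0 : ℝ) < (2 : ℝ≥0∞).toReal := by norm_num
      refine lp.norm_le_of_forall_sum_le h2 (by positivity) (fun s => ?_)
      rw [Real.mul_rpow (abs_nonneg _) (norm_nonneg _), lp.norm_rpow_eq_tsum h2]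
      have hs : Summable fun c => ‖ψ c‖ ^ (2 : ℝ≥0∞).toReal :=
        (memℓp_gen_iff h2).1 (lp.memℓp ψ)
      calc ∑ c ∈ s, ‖k c * ψ (σ c)‖ ^ (2 : ℝ≥0∞).toReal
          ≤ ∑ c ∈ s, |C| ^ (2 : ℝ≥0∞).toReal * ‖ψ (σ c)‖ ^ (2 : ℝ≥0∞).toReal := by
            refine Finset.sum_le_sum fun c _ => ?_
            rw [norm_mul, Real.mul_rpow (norm_nonneg _) (norm_nonneg _)]
            gcongr
            exact (hk c).trans (le_abs_self C)
        _ = |C| ^ (2 : ℝ≥0∞).toReal * ∑ c ∈ s, ‖ψ (σ c)‖ ^ (2 : ℝ≥0∞).toReal := by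
            rw [Finset.mul_sum]
        _ ≤ |C| ^ (2 : ℝ≥0∞).toReal * ∑' c, ‖ψ c‖ ^ (2 : ℝ≥0∞).toReal := by
            gcongr
            rw [← σ.tsum_eq (fun c => ‖ψ c‖ ^ (2 : ℝ≥0∞).toReal)]
            exact (hs.comp_injective σ.injective).sum_le_tsum s (fun c _ => by positivity))

lemma weighted_apply (k : Config G → ℂ) (σ : Equiv.Perm (Config G)) (C : ℝ)
    (hk : ∀ c, ‖k c‖ ≤ C) (ψ : Hilb G) (c : Config G) :
    weighted k σ C hk ψ c = k c * ψ (σ c) := rfl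

variable [CommGroup G] [Fintype G] [DecidableEq G]

/-- The action of `M ∈ M_{|G|^|Λ|}(ℂ)` on `ℓ²(G^𝓑)`, written as a finite sum of bounded operators;
the formula that characterises it is `localOpAux_apply`. -/
def localOpAux (Λ : Finset Edge) (M : Matrix (Λ → G) (Λ → G) ℂ) : Hilb G →L[ℂ] Hilb G :=
  ∑ h : Λ → G, weighted (fun c => M (Λ.restrict c) (h * Λ.restrict c))
    (Equiv.mulLeft (glue Λ 1 h)) (∑ a, ∑ b, ‖M a b‖) (fun c =>
      (Finset.single_le_sum (f := fun b => ‖M (Λ.restrict c) b‖)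
        (fun _ _ => norm_nonneg _) (Finset.mem_univ _)).trans
      (Finset.single_le_sum (f := fun a => ∑ b, ‖M a b‖)
        (fun _ _ => Finset.sum_nonneg fun _ _ => norm_nonneg _) (Finset.mem_univ _)))

lemma hilb_sum_apply {ι : Type*} (s : Finset ι) (F : ι → Hilb G →L[ℂ] Hilb G) (ψ : Hilb G)
    (c : Config G) : (∑ i ∈ s, F i) ψ c = ∑ i ∈ s, F i ψ c := by
  rw [_root_.sum_apply, lp.coeFn_sum, Finset.sum_apply]

lemma glue_one_mul (Λ : Finset Edge) (h : Λ → G) (c : Config G) :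
    glue Λ 1 h * c = glue Λ c (h * Λ.restrict c) := by
  funext e
  by_cases he : e ∈ Λ <;> simp [glue, he]

/-- `M` acts on the coordinates in `Λ` by matrix multiplication. -/
lemma localOpAux_apply (Λ : Finset Edge) (M : Matrix (Λ → G) (Λ → G) ℂ) (ψ : Hilb G)
    (c : Config G) :
    localOpAux Λ M ψ c = ∑ a : Λ → G, M (Λ.restrict c) a * ψ (glue Λ c a) := by
  rw [localOpAux, hilb_sum_apply]
  refine Fintype.sum_equiv (Equiv.mulRight (Λ.restrict c)) _ _ (fun h => ?_)
  rw [weighted_apply]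
  change _ * ψ (glue Λ 1 h * c) = M (Λ.restrict c) (h * Λ.restrict c) *
    ψ (glue Λ c (h * Λ.restrict c))
  rw [glue_one_mul]

lemma localOpAux_star (Λ : Finset Edge) (M : Matrix (Λ → G) (Λ → G) ℂ) :
    localOpAux Λ (star M) = star (localOpAux Λ M) := by
  rw [ContinuousLinearMap.star_eq_adjoint, ContinuousLinearMap.eq_adjoint_iff]
  intro x y
  simp only [localOpAux, _root_.sum_apply, sum_inner, inner_sum]
  refine Fintype.sum_equiv (Equiv.inv _) _ _ (fun h => ?_)
  rw [lp.inner_eq_tsum, lp.inner_eq_tsum]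
  rw [← (Equiv.mulLeft (glue Λ (1 : Config G) h)).tsum_eq
    (fun c => inner ℂ (x c) _)]
  refine tsum_congr fun c => ?_
  have h1 : glue Λ (1 : Config G) (Equiv.inv (Λ → G) h) * (glue Λ 1 h * c) = c := by
    funext e
    by_cases he : e ∈ Λ <;> simp [glue, he]
  have h2 : Λ.restrict (glue Λ (1 : Config G) h * c) = h * Λ.restrict c := by
    funext e
    simp [glue]
  have h3 : Equiv.inv (Λ → G) h * (h * Λ.restrict c) = Λ.restrict c := by
    funext e
    simp
  simp only [weighted_apply, Equiv.coe_mulLeft, h1, h2, h3, RCLike.inner_apply]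
  simp [Matrix.star_apply]
  ring

/-- The representation of `𝒜_Λ = M_{|G|^|Λ|}(ℂ)` by operators that act on the edges in `Λ`. -/
def localOp (Λ : Finset Edge) :
    Matrix (Λ → G) (Λ → G) ℂ →⋆ₐ[ℂ] (Hilb G →L[ℂ] Hilb G) where
  toFun := localOpAux Λ
  map_one' := by
    ext ψ c
    rw [localOpAux_apply]
    simp [Matrix.one_apply, glue_restrict]
  map_mul' M N := by
    ext ψ c
    rw [mul_apply_eq_comp]
    simp only [localOpAux_apply, restrict_glue, glue_glue, Matrix.mul_apply, Finset.sum_mul,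
      Finset.mul_sum]
    rw [Finset.sum_comm]
    refine Finset.sum_congr rfl fun a _ => Finset.sum_congr rfl fun b _ => ?_
    ring
  map_zero' := by
    ext ψ c
    rw [localOpAux_apply]
    simp
  map_add' M N := by
    ext ψ c
    rw [_root_.add_apply, lp.coeFn_add, Pi.add_apply]
    simp only [localOpAux_apply, Matrix.add_apply, add_mul, Finset.sum_add_distrib]
  commutes' z := by
    ext ψ c
    rw [localOpAux_apply]
    simp [Matrix.algebraMap_matrix_apply, glue_restrict, Algebra.algebraMap_eq_smul_one]
  map_star' M := localOpAux_star Λ M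

lemma localOp_apply (Λ : Finset Edge) (M : Matrix (Λ → G) (Λ → G) ℂ) (ψ : Hilb G)
    (c : Config G) :
    localOp Λ M ψ c = ∑ a : Λ → G, M (Λ.restrict c) a * ψ (glue Λ c a) :=
  localOpAux_apply Λ M ψ c

/-- The representation of `𝒜_Λ` is faithful. -/
lemma localOp_injective (Λ : Finset Edge) :
    Function.Injective (localOp (G := G) Λ) := by
  classical
  intro M N h
  ext a b
  have h1 := congrArg (fun T : Hilb G →L[ℂ] Hilb G =>
    T (lp.single 2 (glue Λ 1 b) (1 : ℂ)) (glue Λ 1 a)) h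
  have key : ∀ a' : Λ → G, glue Λ (1 : Config G) a' = glue Λ 1 b ↔ a' = b := fun a' =>
    ⟨fun h => by rw [← restrict_glue Λ 1 a', h, restrict_glue], fun h => by rw [h]⟩
  simpa [localOp_apply, restrict_glue, glue_glue, lp.single_apply, Pi.single_apply, key] using h1

/-- The inclusion `A ↦ A ⊗ I` of `𝒜_Λ₁` into `𝒜_Λ₂` for `Λ₁ ⊆ Λ₂`. -/
def tensorId {Λ₁ Λ₂ : Finset Edge} (h : Λ₁ ⊆ Λ₂) (M : Matrix (Λ₁ → G) (Λ₁ → G) ℂ) :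
    Matrix (Λ₂ → G) (Λ₂ → G) ℂ :=
  fun a b => if ∀ e : Λ₂, (e : Edge) ∉ Λ₁ → a e = b e then
    M (fun e => a ⟨e, h e.2⟩) (fun e => b ⟨e, h e.2⟩) else 0

/-- The representations are compatible with the inclusions of the local algebras. -/
lemma localOp_tensorId {Λ₁ Λ₂ : Finset Edge} (h : Λ₁ ⊆ Λ₂) (M : Matrix (Λ₁ → G) (Λ₁ → G) ℂ) :
    localOp Λ₂ (tensorId h M) = localOp Λ₁ M := by
  ext ψ c
  rw [localOp_apply, localOp_apply]
  symm
  refine Fintype.sum_of_injective (fun a => Λ₂.restrict (glue Λ₁ c a)) ?_ _ _ ?_ ?_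
  · intro a b hab
    funext e
    have := congrFun hab ⟨e, h e.2⟩
    simpa [glue] using this
  · intro b hb
    simp only [tensorId]
    rw [if_neg, zero_mul]
    intro hb'
    refine hb ⟨fun e => b ⟨e, h e.2⟩, ?_⟩
    funext e
    by_cases he : (e : Edge) ∈ Λ₁
    · simp [glue, he]
    · simpa [glue, he] using hb' e he
  · intro a
    simp only [tensorId]
    rw [if_pos]
    · congr 1
      · congr 1
        funext e
        simp [glue]
      · refine congrArg (ψ : Config G → ℂ) ?_
        funext e
        by_cases he : e ∈ Λ₂
        · simp [glue, he]
        · have : e ∉ Λ₁ := fun h' => he (h h')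
          simp [glue, he, this]
    · intro e he
      simp [glue, he]

variable (G)

/-- The algebra `𝒜_loc` of local observables, the union of all the `𝒜_Λ`, `Λ` finite. -/
def localAlgebra : StarSubalgebra ℂ (Hilb G →L[ℂ] Hilb G) where
  carrier := ⋃ Λ : Finset Edge, Set.range (localOp (G := G) Λ)
  mul_mem' := by
    rintro a b ha hb
    simp only [Set.mem_iUnion, Set.mem_range] at ha hb ⊢
    obtain ⟨Λ, M, rfl⟩ := ha
    obtain ⟨Λ', N, rfl⟩ := hb
    refine ⟨Λ ∪ Λ', tensorId Finset.subset_union_left M * tensorId Finset.subset_union_right N, ?_⟩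
    rw [map_mul, localOp_tensorId, localOp_tensorId]
  add_mem' := by
    rintro a b ha hb
    simp only [Set.mem_iUnion, Set.mem_range] at ha hb ⊢
    obtain ⟨Λ, M, rfl⟩ := ha
    obtain ⟨Λ', N, rfl⟩ := hb
    refine ⟨Λ ∪ Λ', tensorId Finset.subset_union_left M + tensorId Finset.subset_union_right N, ?_⟩
    rw [map_add, localOp_tensorId, localOp_tensorId]
  algebraMap_mem' z := by
    simp only [Set.mem_iUnion, Set.mem_range]
    exact ⟨∅, algebraMap _ _ z, AlgHomClass.commutes _ _⟩
  star_mem' := by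
    rintro a ha
    simp only [Set.mem_iUnion, Set.mem_range] at ha ⊢
    obtain ⟨Λ, M, rfl⟩ := ha
    exact ⟨Λ, star M, map_star _ _⟩

/-- The C*-algebra `𝒜` of quasi-local observables: the norm closure of `𝒜_loc`. -/
abbrev QuasiLocal : Type _ := (localAlgebra G).topologicalClosure

variable {G}

/-- A quasi-local observable that belongs to `𝒜_loc`. -/
def IsLocal (A : QuasiLocal G) : Prop := (A : Hilb G →L[ℂ] Hilb G) ∈ localAlgebra G

lemma localOp_mem (Λ : Finset Edge) (M : Matrix (Λ → G) (Λ → G) ℂ) :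
    localOp Λ M ∈ localAlgebra G := Set.mem_iUnion.2 ⟨Λ, M, rfl⟩

/-- An element of `𝒜_Λ`, regarded as a quasi-local observable. -/
def localObs (Λ : Finset Edge) (M : Matrix (Λ → G) (Λ → G) ℂ) : QuasiLocal G :=
  ⟨localOp Λ M, (localAlgebra G).le_topologicalClosure (localOp_mem Λ M)⟩

lemma coe_localObs (Λ : Finset Edge) (M : Matrix (Λ → G) (Λ → G) ℂ) :
    (localObs Λ M : Hilb G →L[ℂ] Hilb G) = localOp Λ M := rfl

lemma commute_localObs {Λ Λ' : Finset Edge} (h : Disjoint Λ Λ') (M : Matrix (Λ → G) (Λ → G) ℂ)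
    (N : Matrix (Λ' → G) (Λ' → G) ℂ) : Commute (localObs Λ M) (localObs Λ' N) := by
  refine Subtype.ext ?_
  change localOp Λ M * localOp Λ' N = localOp Λ' N * localOp Λ M
  ext ψ c
  rw [mul_apply_eq_comp, mul_apply_eq_comp]
  simp only [localOp_apply, Finset.mul_sum]
  rw [Finset.sum_comm]
  refine Finset.sum_congr rfl fun b _ => Finset.sum_congr rfl fun a _ => ?_
  have h1 : Λ'.restrict (glue Λ c a) = Λ'.restrict c := by
    funext e
    have : (e : Edge) ∉ Λ := fun h' => Finset.disjoint_left.1 h h' e.2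
    simp [glue, this]
  have h2 : Λ.restrict (glue Λ' c b) = Λ.restrict c := by
    funext e
    have : (e : Edge) ∉ Λ' := fun h' => Finset.disjoint_left.1 h e.2 h'
    simp [glue, this]
  have h3 : glue Λ' (glue Λ c a) b = glue Λ (glue Λ' c b) a := by
    funext e
    by_cases he : e ∈ Λ
    · have : e ∉ Λ' := fun h' => Finset.disjoint_left.1 h he h'
      simp [glue, he, this]
    · simp [glue, he]
  rw [h1, h2, h3]
  ring

/-! ### Star and plaquette operators, local Hamiltonians -/

/-- The group element by which the star operator `A_v^g` multiplies the label of an edge: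
`g` on the edges that leave `v`, `g⁻¹` on the edges that enter `v`. -/
def starShift (v : ℤ × ℤ) (g : G) (e : Edge) : G :=
  if Edge.src e = v then g else if Edge.tgt e = v then g⁻¹ else 1

/-- The star operator `A_v^g ∈ 𝒜_v`, given by `A_v^g |b⟩ = |b'⟩` with `b' e = g * b e` if `e` leaves
`v` and `b' e = b e * g⁻¹` if `e` enters `v`. -/
def starOp (v : ℤ × ℤ) (g : G) : QuasiLocal G :=
  localObs (star4 v) (Matrix.of fun a b =>
    if a = (fun e : star4 v => starShift v g e * b e) then 1 else 0)

/-- The monodromy of a connection around a plaquette, read clockwise: up the left edge, along the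
top edge, down the right edge and back along the bottom edge. -/
def monodromy (f : ℤ × ℤ) (b : plaq4 f → G) : G :=
  b ⟨(f, true), by simp [plaq4]⟩ * b ⟨(f + (0, 1), false), by simp [plaq4]⟩ *
    (b ⟨(f + (1, 0), true), by simp [plaq4]⟩)⁻¹ * (b ⟨(f, false), by simp [plaq4]⟩)⁻¹

/-- The plaquette operator `B_f^h ∈ 𝒜_f`, given by `B_f^h |b⟩ = |b⟩` if the monodromy of `b` around
`f` is `h`, and `B_f^h |b⟩ = 0` otherwise. -/
def plaqOp (f : ℤ × ℤ) (h : G) : QuasiLocal G :=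
  localObs (plaq4 f) (Matrix.diagonal fun b => if monodromy f b = h then 1 else 0)

variable (G)

/-- `A_v = |G|⁻¹ ∑_g A_v^g`. -/
def starTerm (v : ℤ × ℤ) : QuasiLocal G := (Fintype.card G : ℂ)⁻¹ • ∑ g : G, starOp v g

/-- `B_f = B_f^e`. -/
def plaqTerm (f : ℤ × ℤ) : QuasiLocal G := plaqOp f 1

/-- The local Hamiltonian `H_L = ∑_v (I - A_v) + ∑_f (I - B_f)` of the box `Λ_L`. -/
def hamiltonian (L : ℕ) : QuasiLocal G :=
  ∑ v ∈ starsIn L, (1 - starTerm G v) + ∑ f ∈ plaqsIn L, (1 - plaqTerm G f)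

variable {G}

/-- The derivation `δ(A) = lim_L [H_L, A]`, for `A ∈ 𝒜_loc`; that the limit exists is
`tendsto_derivation`. -/
def derivation (A : QuasiLocal G) : QuasiLocal G :=
  limUnder atTop (fun L : ℕ => hamiltonian G L * A - A * hamiltonian G L)

/-! ### Charge projectors -/

lemma starShift_eq_one {v : ℤ × ℤ} {e : Edge} (h : e ∉ star4 v) (g : G) :
    starShift v g e = 1 := by
  obtain ⟨w, d⟩ := e
  have h1 : w ≠ v := by
    rintro rfl
    cases d <;> simp [star4] at h
  have h2 : Edge.tgt (w, d) ≠ v := by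
    rintro rfl
    cases d <;> simp [star4, Edge.tgt] at h
  simp [starShift, Edge.src, h1, h2]

lemma starOp_apply (v : ℤ × ℤ) (g : G) (ψ : Hilb G) (c : Config G) :
    (starOp v g : Hilb G →L[ℂ] Hilb G) ψ c = ψ (fun e => (starShift v g e)⁻¹ * c e) := by
  rw [starOp, coe_localObs, localOp_apply]
  have key : ∀ a : star4 v → G, ((star4 v).restrict c = fun e : star4 v => starShift v g e * a e) ↔
      a = fun e : star4 v => (starShift v g e)⁻¹ * c e := by
    intro a
    simp only [funext_iff, Finset.restrict]
    exact forall_congr' fun e =>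
      ⟨fun h => by rw [h, inv_mul_cancel_left], fun h => by rw [h, mul_inv_cancel_left]⟩
  simp only [Matrix.of_apply, key, ite_mul, one_mul, zero_mul, Finset.sum_ite_eq',
    Finset.mem_univ, if_true]
  refine congrArg (ψ : Config G → ℂ) ?_
  funext e
  by_cases he : e ∈ star4 v
  · simp [glue, he]
  · simp [glue, he, starShift_eq_one he]

lemma commute_starOp (v w : ℤ × ℤ) (g h : G) : Commute (starOp v g) (starOp w h) := by
  refine Subtype.ext ?_
  ext ψ c
  change (starOp v g : Hilb G →L[ℂ] Hilb G) ((starOp w h : Hilb G →L[ℂ] Hilb G) ψ) c =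
    (starOp w h : Hilb G →L[ℂ] Hilb G) ((starOp v g : Hilb G →L[ℂ] Hilb G) ψ) c
  simp only [starOp_apply]
  refine congrArg (ψ : Config G → ℂ) ?_
  funext e
  exact mul_left_comm _ _ _

lemma plaqOp_apply (f : ℤ × ℤ) (h : G) (ψ : Hilb G) (c : Config G) :
    (plaqOp f h : Hilb G →L[ℂ] Hilb G) ψ c =
      (if monodromy f ((plaq4 f).restrict c) = h then 1 else 0) * ψ c := by
  rw [plaqOp, coe_localObs, localOp_apply]
  simp [Matrix.diagonal_apply, glue_restrict]

lemma commute_plaqOp (f f' : ℤ × ℤ) (h h' : G) : Commute (plaqOp f h) (plaqOp f' h') := by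
  refine Subtype.ext ?_
  ext ψ c
  change (plaqOp f h : Hilb G →L[ℂ] Hilb G) ((plaqOp f' h' : Hilb G →L[ℂ] Hilb G) ψ) c =
    (plaqOp f' h' : Hilb G →L[ℂ] Hilb G) ((plaqOp f h : Hilb G →L[ℂ] Hilb G) ψ) c
  simp only [plaqOp_apply]
  exact mul_left_comm _ _ _

variable (G)

/-- The dual group `Ĝ` of characters of `G`. -/
abbrev Dual : Type _ := G →* ℂˣ

instance : Fintype (Dual G) := Fintype.ofFinite _

variable {G}

/-- The projector `D_v^χ = |G|⁻¹ ∑_g conj(χ(g)) A_v^g` on electric charge `χ` at `v`. -/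
def electricProj (v : ℤ × ℤ) (χ : Dual G) : QuasiLocal G :=
  (Fintype.card G : ℂ)⁻¹ • ∑ g : G, star (χ g : ℂ) • starOp v g

/-- The projector `D_f^c = B_f^c` on magnetic charge `c` at `f`. -/
def magneticProj (f : ℤ × ℤ) (c : G) : QuasiLocal G := plaqOp f c

lemma commute_electricProj (v w : ℤ × ℤ) (χ ξ : Dual G) :
    Commute (electricProj v χ) (electricProj w ξ) :=
  ((Commute.sum_left _ _ _ fun g _ => Commute.sum_right _ _ _ fun h _ =>
    ((commute_starOp v w g h).smul_left _).smul_right _).smul_left _).smul_right _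

open scoped Classical in
/-- The global electric charge projector `D_L^χ`: the sum over all the configurations `κ` of
electric charges on the stars in `Λ_L` with `∏_v κ_v = χ` of `∏_v D_v^{κ_v}`. -/
def globalElectric (L : ℕ) (χ : Dual G) : QuasiLocal G :=
  ∑ κ : starsIn L → Dual G with ∏ v, κ v = χ,
    Finset.univ.noncommProd (fun v : starsIn L => electricProj (v : ℤ × ℤ) (κ v))
      (fun v _ w _ _ => commute_electricProj v w (κ v) (κ w))

open scoped Classical in
/-- The global magnetic charge projector `D_L^c`: the sum over all the configurations `κ` of
magnetic charges on the plaquettes in `Λ_L` with `∏_f κ_f = c` of `∏_f D_f^{κ_f}`. -/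
def globalMagnetic (L : ℕ) (c : G) : QuasiLocal G :=
  ∑ κ : plaqsIn L → G with ∏ f, κ f = c,
    Finset.univ.noncommProd (fun f : plaqsIn L => magneticProj (f : ℤ × ℤ) (κ f))
      (fun f _ f' _ _ => commute_plaqOp f f' (κ f) (κ f'))

/-- The global charge projector `D_L^{χ,c} = D_L^χ D_L^c`, for `p = (χ, c)`. -/
def globalCharge (L : ℕ) (p : Dual G × G) : QuasiLocal G :=
  globalElectric L p.1 * globalMagnetic L p.2

/-! ### Existence of the derivation -/

lemma vertexBox_mono {L L' : ℕ} (h : L ≤ L') : vertexBox L ⊆ vertexBox L' := by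
  have : (L : ℤ) ≤ L' := by exact_mod_cast h
  exact Finset.Icc_subset_Icc ⟨by simpa using this, by simpa using this⟩ ⟨this, this⟩

lemma edgeBox_mono {L L' : ℕ} (h : L ≤ L') : edgeBox L ⊆ edgeBox L' := by
  intro e he
  simp only [edgeBox, Finset.mem_filter, Finset.mem_product, Finset.mem_univ, and_true] at he ⊢
  exact ⟨vertexBox_mono h he.1, vertexBox_mono h he.2⟩

lemma starsIn_mono {L L' : ℕ} (h : L ≤ L') : starsIn L ⊆ starsIn L' := by
  intro e he
  simp only [starsIn, Finset.mem_filter] at he ⊢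
  exact ⟨vertexBox_mono h he.1, he.2.trans (edgeBox_mono h)⟩

lemma plaqsIn_mono {L L' : ℕ} (h : L ≤ L') : plaqsIn L ⊆ plaqsIn L' := by
  intro e he
  simp only [plaqsIn, Finset.mem_filter] at he ⊢
  exact ⟨vertexBox_mono h he.1, he.2.trans (edgeBox_mono h)⟩

lemma mem_edgeBox {L : ℕ} (e : Edge) : e ∈ edgeBox L ↔
    (-(L : ℤ) ≤ e.1.1 ∧ e.1.1 ≤ L ∧ -(L : ℤ) ≤ e.1.2 ∧ e.1.2 ≤ L) ∧
      if e.2 then e.1.2 + 1 ≤ L else e.1.1 + 1 ≤ L := by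
  obtain ⟨⟨x, y⟩, d⟩ := e
  cases d <;>
    simp [edgeBox, vertexBox, Edge.tgt, Prod.le_def] <;> omega

/-- A star that meets `Λ_L` is contained in `Λ_{L+1}`. -/
lemma star_disjoint {L : ℕ} {v : ℤ × ℤ} (h : v ∉ starsIn (L + 1)) :
    Disjoint (star4 v) (edgeBox L) := by
  obtain ⟨x, y⟩ := v
  rw [Finset.disjoint_left]
  intro e he hL
  refine h ?_
  rw [mem_edgeBox] at hL
  simp only [starsIn, Finset.mem_filter, vertexBox, Finset.mem_Icc, Prod.le_def]
  simp only [star4, Finset.mem_insert, Finset.mem_singleton] at he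
  have hxy : -(L : ℤ) ≤ x ∧ x ≤ L ∧ -(L : ℤ) ≤ y ∧ y ≤ L := by
    rcases he with rfl | rfl | rfl | rfl <;> simp at hL <;> omega
  refine ⟨by push_cast; omega, ?_⟩
  intro e' he'
  rw [mem_edgeBox]
  simp only [star4, Finset.mem_insert, Finset.mem_singleton] at he'
  rcases he' with rfl | rfl | rfl | rfl <;> simp <;> omega

/-- A plaquette that meets `Λ_L` is contained in `Λ_{L+1}`. -/
lemma plaq_disjoint {L : ℕ} {f : ℤ × ℤ} (h : f ∉ plaqsIn (L + 1)) :
    Disjoint (plaq4 f) (edgeBox L) := by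
  obtain ⟨x, y⟩ := f
  rw [Finset.disjoint_left]
  intro e he hL
  refine h ?_
  rw [mem_edgeBox] at hL
  simp only [plaqsIn, Finset.mem_filter, vertexBox, Finset.mem_Icc, Prod.le_def]
  simp only [plaq4, Finset.mem_insert, Finset.mem_singleton] at he
  have hxy : -(L : ℤ) - 1 ≤ x ∧ x ≤ L ∧ -(L : ℤ) - 1 ≤ y ∧ y ≤ L := by
    rcases he with rfl | rfl | rfl | rfl <;> simp at hL <;> omega
  refine ⟨by push_cast; omega, ?_⟩
  intro e' he'
  rw [mem_edgeBox]
  simp only [plaq4, Finset.mem_insert, Finset.mem_singleton] at he'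
  rcases he' with rfl | rfl | rfl | rfl <;> simp <;> omega

lemma exists_edgeBox (Λ : Finset Edge) : ∃ L : ℕ, Λ ⊆ edgeBox L := by
  induction Λ using Finset.induction_on with
  | empty => exact ⟨0, Finset.empty_subset _⟩
  | insert e s _ ih =>
    obtain ⟨L, hL⟩ := ih
    refine ⟨max L (e.1.1.natAbs + e.1.2.natAbs + 1), Finset.insert_subset ?_
      (hL.trans (edgeBox_mono (le_max_left _ _)))⟩
    refine edgeBox_mono (le_max_right _ _) ?_
    rw [mem_edgeBox]
    simp only [Nat.cast_add, Nat.cast_one, Int.natCast_natAbs]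
    have h1 := neg_abs_le e.1.1
    have h2 := neg_abs_le e.1.2
    have h3 := le_abs_self e.1.1
    have h4 := le_abs_self e.1.2
    have h5 := abs_nonneg e.1.1
    have h6 := abs_nonneg e.1.2
    refine ⟨by refine ⟨?_, ?_, ?_, ?_⟩ <;> linarith, ?_⟩
    split_ifs <;> linarith

/-- The limit that defines `δ(A)` exists for every local observable `A`. -/
lemma tendsto_derivation {A : QuasiLocal G} (hA : IsLocal A) :
    Tendsto (fun L : ℕ => hamiltonian G L * A - A * hamiltonian G L) atTop
      (𝓝 (derivation A)) := by
  refine tendsto_nhds_limUnder ?_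
  obtain ⟨Λ, M, hM⟩ := Set.mem_iUnion.1 hA
  obtain ⟨L₀, hL₀⟩ := exists_edgeBox Λ
  have hA' : A = localObs Λ M := Subtype.ext hM.symm
  refine ⟨hamiltonian G (L₀ + 1) * A - A * hamiltonian G (L₀ + 1), ?_⟩
  refine tendsto_const_nhds.congr' ?_
  filter_upwards [eventually_ge_atTop (L₀ + 1)] with L hL
  have hc : Commute (hamiltonian G L - hamiltonian G (L₀ + 1)) A := by
    have e1 := Finset.sum_sdiff (f := fun v => 1 - starTerm G v) (starsIn_mono hL)
    have e2 := Finset.sum_sdiff (f := fun f => 1 - plaqTerm G f) (plaqsIn_mono hL)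
    have e3 : hamiltonian G L - hamiltonian G (L₀ + 1) =
        ∑ v ∈ starsIn L \ starsIn (L₀ + 1), (1 - starTerm G v) +
          ∑ f ∈ plaqsIn L \ plaqsIn (L₀ + 1), (1 - plaqTerm G f) := by
      rw [hamiltonian, hamiltonian, ← e1, ← e2]
      abel
    rw [e3, hA']
    refine Commute.add_left (Commute.sum_left _ _ _ fun v hv => ?_)
      (Commute.sum_left _ _ _ fun f hf => ?_)
    · refine (Commute.one_left _).sub_left (Commute.smul_left ?_ _)
      exact Commute.sum_left _ _ _ fun g _ => commute_localObs
        ((star_disjoint (Finset.mem_sdiff.1 hv).2).mono_right hL₀) _ _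
    · exact (Commute.one_left _).sub_left (commute_localObs
        ((plaq_disjoint (Finset.mem_sdiff.1 hf).2).mono_right hL₀) _ _)
  have h := hc.eq
  rw [sub_mul, mul_sub] at h
  rw [sub_eq_sub_iff_add_eq_add] at h ⊢
  rw [add_comm, ← h, add_comm]

/-! ### States and ground states -/

/-- A state on `𝒜`: a normalised positive functional (the positive elements of a C*-algebra are
those of the form `A* A`). The type `WeakDual` carries the weak* topology. -/
def IsState (ω : WeakDual ℂ (QuasiLocal G)) : Prop :=
  (∀ A : QuasiLocal G, 0 ≤ ω (star A * A)) ∧ ω 1 = 1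

variable (G)

/-- The set `K` of infinite-volume ground states: states with `ω(A* δ(A)) ≥ 0` for all local
`A`. The order on `ℂ` is such that `0 ≤ z` says that `z` is real and non-negative. -/
def groundStates : Set (WeakDual ℂ (QuasiLocal G)) :=
  {ω | IsState ω ∧ ∀ A : QuasiLocal G, IsLocal A → 0 ≤ ω (star A * derivation A)}

variable {G}

/-- The functional `ω( · D)`. -/
def rightMul (ω : WeakDual ℂ (QuasiLocal G)) (D : QuasiLocal G) : WeakDual ℂ (QuasiLocal G) :=
  StrongDual.toWeakDual
    ((WeakDual.toStrongDual ω).comp ((ContinuousLinearMap.mul ℂ (QuasiLocal G)).flip D))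

lemma rightMul_apply (ω : WeakDual ℂ (QuasiLocal G)) (D A : QuasiLocal G) :
    rightMul ω D A = ω (A * D) := rfl

/-- The functional `ω( · D_L^{χ,c}) / ω(D_L^{χ,c})`, for `p = (χ, c)`. -/
def chargeComponent (ω : WeakDual ℂ (QuasiLocal G)) (p : Dual G × G) (L : ℕ) :
    WeakDual ℂ (QuasiLocal G) :=
  (ω (globalCharge L p))⁻¹ • rightMul ω (globalCharge L p)

/-- The set `K^{χ,c}` of charged states, for `p = (χ, c)`: states `φ` for which there is a ground
state `ω` such that `lim_L ω(D_L^{χ,c})` exists and is positive, and `φ` is the weak* limit of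
`ω( · D_L^{χ,c}) / ω(D_L^{χ,c})`. -/
def chargedStates (p : Dual G × G) : Set (WeakDual ℂ (QuasiLocal G)) :=
  {φ | IsState φ ∧ ∃ ω ∈ groundStates G,
    (∃ l : ℝ, 0 < l ∧ Tendsto (fun L => ω (globalCharge L p)) atTop (𝓝 (l : ℂ))) ∧
    Tendsto (fun L => chargeComponent ω p L) atTop (𝓝 φ)}

end Algebra

end QuantumDouble

end

/-!
A charge at a vertex (an element of `Ĝ`) or at a face (an element of `G`) is a joint eigenvalue of
a family of commuting projections, and both kinds of charge obey the same rules: the Hamiltonian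
counts the charged sites, a charge can be moved between any two sites by a local unitary that leaves
the other kind of charge alone (`exists_isTransport_electric`, `exists_isTransport_magnetic`), and
the total charge of a box is measured by an operator on its boundary, so that it commutes with every
local observable once the box is large. `IsChargeModel` collects these rules, and
`ChargeFamily.total` is the projection on a given total charge of a finite region.

Let `ω` be a ground state. If two sites carried non-trivial charges with positive probability, moving
one of them onto the other would lower the energy, against `ω(A* δ(A)) ≥ 0`; so no two sites are
charged simultaneously (`IsChargeModel.map_proj_mul_proj`). The expected number of charged sites is
then at most one, and the total charges of two large boxes differ only if the region between the
boxes is charged, which has small probability. So the `D_L^{χ,c}` form a Cauchy sequence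
in the seminorm `ω(A* A)^(1/2)` (`exists_bound_globalCharge`), and by the Cauchy-Schwarz inequality
`ω(A D_L^{χ,c})` converges for every `A`. The limit is positive in `A` because `D_L^{χ,c}`
is a projection that asymptotically commutes with local observables (`nonneg_of_tendsto_rightMul`).
Where it is not zero, its normalisation is the component `ω^{χ,c}`, with `ω` itself as the
witness that it lies in `K^{χ,c}`. The components add up to `ω` because `∑ D_L^{χ,c} = 1`.

For a component of weight zero some element of `K^{χ,c}` is needed, hence a ground state
of total charge `(χ, c)` (`exists_groundState_map_globalCharge`). Transporting charges out
of a box gives unit vectors with charge `χ` and flux `c` at the origin and no other charge in the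
box. A weak* limit point of their vector states is a ground state, since a local operation cannot
change the total charge of a large box, and a non-trivial total charge costs at least as much energy
as a single charge.
-/

/-! ### Positive functionals on star algebras -/

namespace PositiveFunctional

section Noncommutative

variable {R : Type*} [Ring R] [StarRing R] [Algebra ℂ R] [StarModule ℂ R]
  {ω : R →ₗ[ℂ] ℂ}

/-- A positive functional is hermitian, by polarisation. -/
lemma map_star (hω : ∀ A, 0 ≤ ω (star A * A)) (h1 : ω 1 = 1) (A : R) :
    ω (star A) = star (ω A) := by
  have e0 : (ω (star A * A)).im = 0 := ((Complex.nonneg_iff.1 (hω A)).2).symm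
  have e1 := ((Complex.nonneg_iff.1 (hω (A + 1))).2).symm
  have e2 := ((Complex.nonneg_iff.1 (hω (A + algebraMap ℂ R Complex.I))).2).symm
  have s1 : star (A + 1) * (A + 1) = star A * A + star A + A + 1 := by
    rw [star_add, star_one]; noncomm_ring
  have s2 : star (A + algebraMap ℂ R Complex.I) * (A + algebraMap ℂ R Complex.I) =
      star A * A + Complex.I • star A - Complex.I • A + 1 := by
    have hs : star (algebraMap ℂ R Complex.I) = - algebraMap ℂ R Complex.I := by
      rw [← algebraMap_star_comm, ← map_neg]
      simp
    have hsq : algebraMap ℂ R Complex.I * algebraMap ℂ R Complex.I = -1 := by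
      rw [← map_mul, Complex.I_mul_I, map_neg, map_one]
    rw [star_add, hs, add_mul, mul_add, mul_add, neg_mul, neg_mul, hsq, neg_neg,
      Algebra.smul_def, Algebra.smul_def, Algebra.commutes Complex.I (star A)]
    abel
  rw [s1] at e1
  rw [s2] at e2
  simp only [map_add, map_sub, map_smul, h1, Complex.add_im, Complex.sub_im, e0, smul_eq_mul,
    Complex.mul_im, Complex.I_re, Complex.I_im, Complex.one_im] at e1 e2
  refine Complex.ext ?_ ?_
  · simp only [Complex.star_def, Complex.conj_re]; linarith
  · simp only [Complex.star_def, Complex.conj_im]; linarith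

/-- The Cauchy-Schwarz inequality for the form `(A, B) ↦ ω(A* B)`. -/
lemma cauchy_schwarz (hω : ∀ A, 0 ≤ ω (star A * A)) (h1 : ω 1 = 1) (A B : R) :
    ‖ω (A * B)‖ ^ 2 ≤ (ω (A * star A)).re * (ω (star B * B)).re := by
  let c : PreInnerProductSpace.Core ℂ R :=
    { inner := fun x y => ω (star x * y)
      conj_inner_symm := fun x y => by
        change star (ω (star y * x)) = _
        rw [← map_star hω h1, star_mul, star_star]
      re_inner_nonneg := fun x => (Complex.nonneg_iff.1 (hω x)).1
      add_left := fun x y z => by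
        change ω (star (x + y) * z) = _
        rw [star_add, add_mul, map_add]
      smul_left := fun x y r => by
        change ω (star (r • x) * y) = _
        rw [star_smul, smul_mul_assoc, map_smul]
        rfl }
  have h := @InnerProductSpace.Core.inner_mul_inner_self_le ℂ R _ _ _ c (star A) B
  have e1 : @inner ℂ R c.toInner (star A) B = ω (A * B) := by
    change ω (star (star A) * B) = _
    rw [star_star]
  have e2 : @inner ℂ R c.toInner B (star A) = star (ω (A * B)) := by
    change ω (star B * star A) = _
    rw [← star_mul, map_star hω h1]
  have e3 : @inner ℂ R c.toInner (star A) (star A) = ω (A * star A) := by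
    change ω (star (star A) * star A) = _
    rw [star_star]
  have e4 : @inner ℂ R c.toInner B B = ω (star B * B) := rfl
  rw [e1, e2, e3, e4, norm_star] at h
  rw [sq]
  exact h

lemma nonneg_of_projection (hω : ∀ A, 0 ≤ ω (star A * A)) {P : R} (hs : star P = P)
    (hP : P * P = P) : 0 ≤ ω P := by
  have := hω P
  rwa [hs, hP] at this

/-- A projection of expectation `1` acts as the identity in the state. -/
lemma mul_of_map_eq_one (hω : ∀ A, 0 ≤ ω (star A * A)) (h1 : ω 1 = 1) {P : R} (hs : star P = P)
    (hP : P * P = P) (h : ω P = 1) (A : R) : ω (A * P) = ω A := by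
  have hcs := cauchy_schwarz hω h1 A (1 - P)
  have e : star (1 - P) * (1 - P) = 1 - P := by
    rw [star_sub, star_one, hs, sub_mul, mul_sub, mul_sub, hP]
    simp
  rw [e, map_sub, h1, h, sub_self, Complex.zero_re, mul_zero] at hcs
  have h0 : ω (A * (1 - P)) = 0 := by
    rw [← norm_eq_zero]
    exact pow_eq_zero_iff (two_ne_zero) |>.1 (le_antisymm hcs (by positivity))
  rw [mul_sub, mul_one, map_sub, sub_eq_zero] at h0
  exact h0.symm

end Noncommutative

section Commutative

variable {C : Type*} [CommRing C] [StarRing C] [Algebra ℂ C] [StarModule ℂ C]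
  {ω : C →ₗ[ℂ] ℂ}

lemma nonneg_mul_of_projection (hω : ∀ A, 0 ≤ ω (star A * A)) {P Q : C} (hs : star P = P)
    (hP : P * P = P) (hs' : star Q = Q) (hQ : Q * Q = Q) : 0 ≤ ω (P * Q) := by
  refine nonneg_of_projection hω ?_ ?_
  · rw [star_mul, hs, hs', mul_comm]
  · rw [mul_mul_mul_comm, hP, hQ]

lemma le_of_projection_mul (hω : ∀ A, 0 ≤ ω (star A * A)) {P Q : C} (hs : star P = P)
    (hP : P * P = P) (hs' : star Q = Q) (hQ : Q * Q = Q) (h : P * Q = P) : ω P ≤ ω Q := by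
  have h0 : 0 ≤ ω ((1 - P) * Q) := by
    refine nonneg_mul_of_projection hω ?_ ?_ hs' hQ
    · rw [star_sub, star_one, hs]
    · rw [sub_mul, mul_sub, mul_sub, hP]; simp
  rw [sub_mul, h, one_mul, map_sub] at h0
  exact sub_nonneg.1 h0

end Commutative

/-- Products of projections from two commuting Cauchy sequences: for the differences,
`E F - E' F' = E (F - F') + (E - E') F'` and `(a + b)² ≤ 2 a² + 2 b²`. -/
lemma map_mul_sub_mul_sq_le {C : Type*} [CommRing C] [StarRing C] [Algebra ℂ C] {ω : C →ₗ[ℂ] ℂ}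
    (hω : ∀ A, 0 ≤ ω (star A * A)) {E E' F F' : C} (sE : star E = E) (sE' : star E' = E')
    (sF : star F = F) (sF' : star F' = F') (pE : E * E = E) (pF' : F' * F' = F') :
    (ω ((E * F - E' * F') ^ 2)).re ≤
      2 * ((ω ((E - E') ^ 2)).re + (ω ((F - F') ^ 2)).re) := by
  have q1 := hω (E * (F - F') - (E - E') * F')
  have q2 := hω ((1 - E) * (F - F'))
  have q3 := hω ((1 - F') * (E - E'))
  have e1 : star (E * (F - F') - (E - E') * F') * (E * (F - F') - (E - E') * F') =
      (E * (F - F') - (E - E') * F') ^ 2 := by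
    simp only [star_sub, star_mul, sE, sE', sF, sF']; ring
  have e2 : star ((1 - E) * (F - F')) * ((1 - E) * (F - F')) =
      (F - F') ^ 2 - (E * (F - F')) ^ 2 := by
    simp only [star_sub, star_mul, star_one, sE, sF, sF']
    linear_combination (2 * (F - F') ^ 2) * pE
  have e3 : star ((1 - F') * (E - E')) * ((1 - F') * (E - E')) =
      (E - E') ^ 2 - ((E - E') * F') ^ 2 := by
    simp only [star_sub, star_mul, star_one, sE, sE', sF']
    linear_combination (2 * (E - E') ^ 2) * pF'
  have e4 : (E * F - E' * F') ^ 2 + (E * (F - F') - (E - E') * F') ^ 2 =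
      (2 : ℂ) • ((E * (F - F')) ^ 2 + ((E - E') * F') ^ 2) := by
    rw [two_smul]; ring
  rw [e1] at q1
  rw [e2, map_sub] at q2
  rw [e3, map_sub] at q3
  have e5 := congrArg ω e4
  rw [map_add, map_smul, map_add, smul_eq_mul] at e5
  have r3 := (Complex.le_def.1 q1).1
  have r4 := (Complex.le_def.1 q2).1
  have r5 := (Complex.le_def.1 q3).1
  have r6 := congrArg Complex.re e5
  simp only [Complex.zero_re, Complex.sub_re, Complex.add_re, Complex.mul_re,
    Complex.re_ofNat, Complex.im_ofNat, zero_mul, sub_zero] at r3 r4 r5 r6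
  linarith

lemma star_mul_self_mul_projection {R : Type*} [Ring R] [StarRing R] {P A : R} (hs : star P = P)
    (hP : P * P = P) (h : Commute P A) : star A * A * P = star (A * P) * (A * P) := by
  have h' : Commute P (star A) := by
    have := h.star_star
    rwa [hs] at this
  rw [star_mul, hs, h'.eq, mul_assoc, mul_assoc, ← mul_assoc P, h.eq, mul_assoc A, hP]

lemma isClosed_nonneg {R : Type*} [NormedRing R] [StarRing R] [ContinuousStar R]
    [NormedAlgebra ℂ R] (Φ : WeakDual ℂ R) : IsClosed {A : R | 0 ≤ Φ (star A * A)} :=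
  isClosed_le continuous_const
    ((WeakDual.toStrongDual Φ).continuous.comp (continuous_star.mul continuous_id))

lemma star_mul_commutator {R : Type*} [Ring R] [StarRing R] {H H' U P : R} (hU : star U * U = 1)
    (hs : star P = P) (h : H * U = U * H') :
    star (U * P) * (H * (U * P) - U * P * H) = P * (H' * P - P * H) := by
  rw [← mul_assoc H, h, star_mul, mul_assoc, mul_sub, mul_assoc U, mul_assoc U,
    ← mul_assoc (star U), ← mul_assoc (star U), hU, one_mul, one_mul, hs]

/-- If the elements `D L` form a Cauchy sequence in the seminorm `ω(A* A)^(1/2)`, the functionals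
`ω( · D L)` converge pointwise; the limit is bounded by the uniform boundedness principle. -/
lemma exists_tendsto_mul_right {R : Type*} [NormedRing R] [StarRing R] [NormedAlgebra ℂ R]
    [StarModule ℂ R] [CompleteSpace R] {ω : WeakDual ℂ R} (hω : ∀ A, 0 ≤ ω (star A * A))
    (h1 : ω 1 = 1) {D : ℕ → R} {b : ℕ → ℝ} (hb : CauchySeq b)
    (hD : ∀ L M, L ≤ M → (ω (star (D M - D L) * (D M - D L))).re ≤ b M - b L) :
    ∃ Φ : WeakDual ℂ R, ∀ A, Tendsto (fun L => ω (A * D L)) atTop (𝓝 (Φ A)) := by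
  have hc : ∀ A, ∃ z, Tendsto (fun L => ω (A * D L)) atTop (𝓝 z) := by
    intro A
    refine cauchySeq_tendsto_of_complete ?_
    set K : ℝ := (ω (A * star A)).re
    have hK : 0 ≤ K := by
      have := hω (star A)
      rw [star_star] at this
      exact (Complex.nonneg_iff.1 this).1
    have hest : ∀ L M, L ≤ M → ‖ω (A * D M) - ω (A * D L)‖ ^ 2 ≤ K * (b M - b L) := by
      intro L M h
      rw [← map_sub, ← mul_sub]
      exact (cauchy_schwarz (ω := (WeakDual.toStrongDual ω).toLinearMap) hω h1 _ _).trans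
        (mul_le_mul_of_nonneg_left (hD L M h) hK)
    rw [Metric.cauchySeq_iff'] at hb ⊢
    intro ε hε
    obtain ⟨N, hN⟩ := hb (ε ^ 2 / (K + 1)) (by positivity)
    refine ⟨N, fun n hn => ?_⟩
    have h1 := hest N n hn
    have h2 := hN n hn
    rw [Real.dist_eq, lt_div_iff₀ (by positivity)] at h2
    rw [dist_eq_norm]
    refine lt_of_pow_lt_pow_left₀ 2 hε.le (h1.trans_lt ?_)
    have h3 := le_abs_self (b n - b N)
    have h4 := abs_nonneg (b n - b N)
    nlinarith
  choose f hf using hc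
  exact ⟨StrongDual.toWeakDual (continuousLinearMapOfTendsto
    (fun L => (WeakDual.toStrongDual ω).comp ((ContinuousLinearMap.mul ℂ R).flip (D L))) (f := f)
      (tendsto_pi_nhds.2 hf)), fun A => hf A⟩

lemma eq_zero_of_neg_mul_nonneg {z k : ℂ} (hk : 0 < k) (hz : 0 ≤ z) (h : 0 ≤ -k * z) : z = 0 := by
  have h3 : k * z ≤ 0 := by rwa [neg_mul, neg_nonneg] at h
  exact (mul_eq_zero.1 (le_antisymm h3 (mul_nonneg hk.le hz))).resolve_left hk.ne'

/-- A sequence of functionals in the unit ball has a weak* limit along an ultrafilter. -/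
lemma exists_tendsto_hyperfilter {E : Type*} [NormedAddCommGroup E] [NormedSpace ℂ E]
    (g : ℕ → WeakDual ℂ E) (hg : ∀ L A, ‖g L A‖ ≤ ‖A‖) :
    ∃ ω : WeakDual ℂ E, ∀ A, Tendsto (fun L => g L A) (hyperfilter ℕ) (𝓝 (ω A)) := by
  have hK := WeakDual.isCompact_closedBall (𝕜 := ℂ) (E := E) 0 1
  obtain ⟨ω, -, hω⟩ := hK.ultrafilter_le_nhds ((hyperfilter ℕ).map g) (by
    rw [Ultrafilter.coe_map, le_principal_iff, mem_map]
    refine Filter.univ_mem' fun L => ?_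
    rw [Set.mem_preimage, Set.mem_preimage, mem_closedBall_zero_iff]
    exact ContinuousLinearMap.opNorm_le_bound _ zero_le_one fun A => by
      rw [one_mul]
      exact hg L A)
  exact ⟨ω, fun A => ((WeakDual.eval_continuous A).tendsto ω).comp hω⟩

end PositiveFunctional

/-! ### Families of charge projections in a commutative algebra -/

/-- Charges with values in `X` at the points of `ι`: for every point `v` a partition of unity
`proj v x`, `x ∈ X`, into pairwise orthogonal projections of a commutative star ring. -/
structure ChargeFamily (C ι X : Type*) [CommRing C] [StarRing C] [Fintype X] where
  /-- The projection on charge `x` at `v`. -/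
  proj : ι → X → C
  star_proj : ∀ v x, star (proj v x) = proj v x
  proj_mul_self : ∀ v x, proj v x * proj v x = proj v x
  proj_mul_of_ne : ∀ v x y, x ≠ y → proj v x * proj v y = 0
  sum_proj : ∀ v, ∑ x, proj v x = 1

namespace ChargeFamily

variable {C ι X : Type*} [CommRing C] [StarRing C] [CommGroup X] [Fintype X]
  (D : ChargeFamily C ι X)

/-- The projection on total charge `x` in the finite region `S`. It is the coefficient of `x` in the
product of the elements `∑ y, proj v y • y`, `v ∈ S`, of the group algebra of `X`. -/
noncomputable def total (S : Finset ι) (x : X) : C :=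
  (∏ v ∈ S, ∑ y, MonoidAlgebra.single y (D.proj v y)).coeff x

lemma total_empty [DecidableEq X] (x : X) : D.total ∅ x = if x = 1 then 1 else 0 := by
  rw [total, Finset.prod_empty, MonoidAlgebra.one_def, MonoidAlgebra.coeff_single,
    Finsupp.single_apply]
  simp [eq_comm]

lemma total_insert [DecidableEq ι] {v : ι} {S : Finset ι} (hv : v ∉ S) (x : X) :
    D.total (insert v S) x = ∑ y, D.proj v y * D.total S (y⁻¹ * x) := by
  rw [total, Finset.prod_insert hv, Finset.sum_mul, MonoidAlgebra.coeff_sum, Finset.sum_apply']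
  refine Finset.sum_congr rfl fun y _ => ?_
  rw [MonoidAlgebra.coeff_single_mul_apply]
  rfl

/-- The total charge projection as a sum over charge configurations. -/
lemma total_eq_sum [DecidableEq ι] [DecidableEq X] (S : Finset ι) (x : X) :
    D.total S x = ∑ κ : S → X with ∏ v, κ v = x, ∏ v : S, D.proj (v : ι) (κ v) := by
  rw [total, ← Finset.prod_coe_sort, Finset.prod_univ_sum, Fintype.piFinset_univ]
  have h : ∀ κ : S → X, ∏ v : S, MonoidAlgebra.single (κ v) (D.proj (v : ι) (κ v)) =
      MonoidAlgebra.single (∏ v, κ v) (∏ v : S, D.proj (v : ι) (κ v)) := by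
    intro κ
    induction (Finset.univ : Finset S) using Finset.induction_on with
    | empty => simp [MonoidAlgebra.one_def]
    | insert v s hv ih =>
      rw [Finset.prod_insert hv, Finset.prod_insert hv, Finset.prod_insert hv, ih,
        MonoidAlgebra.single_mul_single]
  simp only [h]
  rw [MonoidAlgebra.coeff_sum, Finset.sum_apply', Finset.sum_filter]
  refine Finset.sum_congr rfl fun κ _ => ?_
  rw [MonoidAlgebra.coeff_single, Finsupp.single_apply]

lemma proj_mul [DecidableEq X] (v : ι) (x y : X) :
    D.proj v x * D.proj v y = if x = y then D.proj v x else 0 := by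
  split_ifs with h
  · rw [← h, D.proj_mul_self]
  · exact D.proj_mul_of_ne v x y h

lemma total_insert_mul_proj [DecidableEq ι] {v : ι} {S : Finset ι} (hv : v ∉ S) (x y : X) :
    D.total (insert v S) x * D.proj v y = D.total S (y⁻¹ * x) * D.proj v y := by
  classical
  rw [D.total_insert hv, Finset.sum_mul, Finset.sum_eq_single y]
  · rw [mul_right_comm, D.proj_mul_self, mul_comm]
  · intro z _ hz
    rw [mul_right_comm, D.proj_mul_of_ne v z y hz, zero_mul]
  · simp

lemma total_union_mul_prod [DecidableEq ι] (κ : ι → X) {S T : Finset ι} (h : Disjoint T S) (x : X) :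
    D.total (T ∪ S) x * ∏ v ∈ T, D.proj v (κ v) =
      D.total S ((∏ v ∈ T, κ v)⁻¹ * x) * ∏ v ∈ T, D.proj v (κ v) := by
  induction T using Finset.induction_on generalizing x with
  | empty => simp
  | insert v T hv ih =>
    rw [Finset.disjoint_insert_left] at h
    have e : (κ v * ∏ u ∈ T, κ u)⁻¹ * x = (∏ u ∈ T, κ u)⁻¹ * ((κ v)⁻¹ * x) := by
      rw [mul_inv_rev, mul_assoc]
    rw [Finset.prod_insert hv, Finset.prod_insert hv, ← mul_assoc, Finset.insert_union,
      D.total_insert_mul_proj (by simp [hv, h.1]), mul_right_comm, ih h.2, e]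
    ring

lemma star_total (S : Finset ι) (x : X) : star (D.total S x) = D.total S x := by
  classical
  induction S using Finset.induction_on generalizing x with
  | empty => rw [total_empty]; split_ifs <;> simp
  | insert v S hv ih =>
    rw [D.total_insert hv, star_sum]
    refine Finset.sum_congr rfl fun y _ => ?_
    rw [star_mul, ih, D.star_proj, mul_comm]

lemma total_mul_total [DecidableEq X] (S : Finset ι) (x y : X) :
    D.total S x * D.total S y = if x = y then D.total S x else 0 := by
  classical
  induction S using Finset.induction_on generalizing x y with
  | empty =>
    simp only [total_empty]
    split_ifs <;> simp_all
  | insert v S hv ih =>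
    rw [D.total_insert hv y, Finset.mul_sum]
    have : ∀ z, D.total (insert v S) x * (D.proj v z * D.total S (z⁻¹ * y)) =
        if x = y then D.proj v z * D.total S (z⁻¹ * x) else 0 := by
      intro z
      rw [← mul_assoc, D.total_insert_mul_proj hv, mul_right_comm, ih, mul_comm]
      simp
    simp only [this]
    split_ifs with hxy
    · rw [D.total_insert hv]
    · simp

lemma total_mul_self (S : Finset ι) (x : X) : D.total S x * D.total S x = D.total S x := by
  classical
  rw [total_mul_total, if_pos rfl]

lemma sum_total (S : Finset ι) : ∑ x, D.total S x = 1 := by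
  classical
  induction S using Finset.induction_on with
  | empty => simp [total_empty]
  | insert v S hv ih =>
    simp only [D.total_insert hv]
    rw [Finset.sum_comm]
    have : ∀ y, ∑ x, D.proj v y * D.total S (y⁻¹ * x) = D.proj v y := by
      intro y
      have := Equiv.sum_comp (Equiv.mulLeft y⁻¹) (D.total S)
      rw [Equiv.coe_mulLeft] at this
      rw [← Finset.mul_sum, this, ih, mul_one]
    simp only [this, D.sum_proj]

lemma star_prod_proj (S : Finset ι) (κ : ι → X) :
    star (∏ v ∈ S, D.proj v (κ v)) = ∏ v ∈ S, D.proj v (κ v) := by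
  rw [star_prod]
  exact Finset.prod_congr rfl fun v _ => D.star_proj _ _

lemma prod_proj_mul_self (S : Finset ι) (κ : ι → X) :
    (∏ v ∈ S, D.proj v (κ v)) * ∏ v ∈ S, D.proj v (κ v) = ∏ v ∈ S, D.proj v (κ v) := by
  rw [← Finset.prod_mul_distrib]
  exact Finset.prod_congr rfl fun v _ => D.proj_mul_self _ _

/-- The charge in a region is unchanged by a larger region that carries no further charge. -/
lemma total_sub_total_mul_prod [DecidableEq ι] {S T : Finset ι} (h : S ⊆ T) (x : X) :
    (D.total T x - D.total S x) * ∏ v ∈ T \ S, D.proj v 1 = 0 := by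
  have := D.total_union_mul_prod (fun _ => 1) (Finset.sdiff_disjoint : Disjoint (T \ S) S) x
  rw [Finset.sdiff_union_of_subset h] at this
  simp only [Finset.prod_const_one, inv_one, one_mul] at this
  rw [sub_mul, this, sub_self]

/-- The change of energy when a charge `x` is moved from `v` to `w`, in a state that carries
charge `x` at `v` and `y` at `w`: a charge disappears at `v`, and possibly at `w`. -/
lemma proj_mul_proj_mul_energy [Algebra ℂ C] [DecidableEq ι] [DecidableEq X] {v w : ι}
    (hvw : v ≠ w) {x y : X} (hx : x ≠ 1) (hy : y ≠ 1) {S : Finset ι} (hv : v ∈ S) (hw : w ∈ S) :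
    D.proj v x * D.proj w y *
      (∑ u ∈ S, (1 - D.proj u ((Pi.mulSingle v x * (Pi.mulSingle w x)⁻¹ : ι → X) u)) -
        ∑ u ∈ S, (1 - D.proj u 1)) =
      (-(if y = x⁻¹ then 2 else 1) : ℂ) • (D.proj v x * D.proj w y) := by
  set P : C := D.proj v x * D.proj w y with hP
  have hPv : ∀ z, P * D.proj v z = if x = z then P else 0 := fun z => by
    rw [hP, mul_right_comm, D.proj_mul]
    split_ifs <;> simp
  have hPw : ∀ z, P * D.proj w z = if y = z then P else 0 := fun z => by
    rw [hP, mul_assoc, D.proj_mul]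
    split_ifs <;> simp
  set t : ι → X := Pi.mulSingle v x * (Pi.mulSingle w x)⁻¹ with ht
  have htv : t v = x := by simp [ht, hvw]
  have htw : t w = x⁻¹ := by simp [ht, hvw.symm]
  have htu : ∀ u, u ≠ v ∧ u ≠ w → t u = 1 := fun u hu => by simp [ht, hu.1, hu.2]
  have e2 : P * (∑ u ∈ S, (1 - D.proj u (t u)) - ∑ u ∈ S, (1 - D.proj u 1)) =
      ∑ u ∈ S, (P * D.proj u 1 - P * D.proj u (t u)) := by
    rw [← Finset.sum_sub_distrib, Finset.mul_sum]
    exact Finset.sum_congr rfl fun u _ => by ring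
  rw [e2, Finset.sum_eq_add_of_mem v w hv hw hvw
    (fun u _ hu => by rw [htu u hu, sub_self]), hPv, hPv, hPw, hPw, htv, htw, if_neg hx,
    if_neg hy, if_pos rfl]
  split_ifs
  · rw [neg_smul, two_smul]; abel
  · rw [neg_smul, one_smul]; abel

variable [Algebra ℂ C] [StarModule ℂ C] {ω : C →ₗ[ℂ] ℂ}

open PositiveFunctional

/-- The union bound for the event that some point of `S` is charged. -/
lemma map_one_sub_prod_le (hω : ∀ A, 0 ≤ ω (star A * A)) (S : Finset ι) :
    ω (1 - ∏ v ∈ S, D.proj v 1) ≤ ∑ v ∈ S, ω (1 - D.proj v 1) := by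
  classical
  induction S using Finset.induction_on with
  | empty => simp
  | insert v S hv ih =>
    rw [Finset.prod_insert hv, Finset.sum_insert hv]
    have e : 1 - D.proj v 1 * ∏ u ∈ S, D.proj u 1 =
        (1 - ∏ u ∈ S, D.proj u 1) + (1 - D.proj v 1) * ∏ u ∈ S, D.proj u 1 := by ring
    have h2 : ω ((1 - D.proj v 1) * ∏ u ∈ S, D.proj u 1) ≤ ω (1 - D.proj v 1) := by
      have e1 : star (1 - D.proj v 1) = 1 - D.proj v 1 := by rw [star_sub, star_one, D.star_proj]
      have e2 : (1 - D.proj v 1) * (1 - D.proj v 1) = 1 - D.proj v 1 := by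
        have := D.proj_mul_self v 1
        linear_combination this
      have s1 := D.star_prod_proj S (fun _ => 1)
      have s2 := D.prod_proj_mul_self S (fun _ => 1)
      refine le_of_projection_mul hω ?_ ?_ e1 e2 ?_
      · rw [star_mul, e1, s1, mul_comm]
      · rw [mul_mul_mul_comm, e2, s2]
      · rw [mul_right_comm, e2]
    rw [e, map_add, add_comm]
    exact add_le_add h2 ih

/-- If no two points are charged simultaneously, the expected number of charged points is at most
one, since `N = ∑ v ∈ S, (1 - proj v 1)` has `ω(N²) = ω(N)` and `ω((1 - N)²) ≥ 0`. -/
lemma sum_map_one_sub_proj_le (hω : ∀ A, 0 ≤ ω (star A * A)) (h1 : ω 1 = 1)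
    (h2 : ∀ v w, v ≠ w → ω ((1 - D.proj v 1) * (1 - D.proj w 1)) = 0) (S : Finset ι) :
    ∑ v ∈ S, ω (1 - D.proj v 1) ≤ 1 := by
  classical
  set N : C := ∑ v ∈ S, (1 - D.proj v 1) with hN
  have hs : star N = N := by
    rw [hN, star_sum]
    exact Finset.sum_congr rfl fun v _ => by rw [star_sub, star_one, D.star_proj]
  have hNN : ω (N * N) = ω N := by
    rw [hN, Finset.sum_mul_sum, map_sum, map_sum]
    refine Finset.sum_congr rfl fun v hv => ?_
    rw [map_sum, Finset.sum_eq_single v]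
    · congr 1
      have := D.proj_mul_self v 1
      linear_combination this
    · exact fun w _ hw => h2 v w hw.symm
    · exact fun h => absurd hv h
  have h := hω (1 - N)
  have e : star (1 - N) * (1 - N) = 1 - N - N + N * N := by
    rw [star_sub, star_one, hs]; ring
  rw [e, map_add, map_sub, map_sub, hNN, h1, sub_add_cancel] at h
  rw [← map_sum]
  exact sub_nonneg.1 h

/-- If no two points are charged simultaneously, the total charge projections of an increasing
sequence of regions form a Cauchy sequence in the seminorm `ω(A* A)^(1/2)`: the square of a
difference is dominated by the increment of a bounded monotone sequence. -/
lemma exists_monotone_bound (hω : ∀ A, 0 ≤ ω (star A * A)) (h1 : ω 1 = 1)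
    (h2 : ∀ v w, v ≠ w → ω ((1 - D.proj v 1) * (1 - D.proj w 1)) = 0)
    (S : ℕ → Finset ι) (hS : Monotone S) :
    ∃ b : ℕ → ℝ, Monotone b ∧ (∀ L, b L ≤ 1) ∧ ∀ L M, L ≤ M → ∀ x,
      ω ((D.total (S M) x - D.total (S L) x) ^ 2) ≤ ((b M - b L : ℝ) : ℂ) := by
  classical
  have hr : ∀ v, (((ω (1 - D.proj v 1)).re : ℝ) : ℂ) = ω (1 - D.proj v 1) ∧
      0 ≤ (ω (1 - D.proj v 1)).re := by
    intro v
    have h : 0 ≤ ω (1 - D.proj v 1) := nonneg_of_projection hω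
      (by rw [star_sub, star_one, D.star_proj])
      (by have := D.proj_mul_self v 1; linear_combination this)
    rw [Complex.nonneg_iff] at h
    exact ⟨Complex.ext rfl (by simpa using h.2), h.1⟩
  refine ⟨fun L => ∑ v ∈ S L, (ω (1 - D.proj v 1)).re, ?_, ?_, ?_⟩
  · intro L M h
    exact Finset.sum_le_sum_of_subset_of_nonneg (hS h) fun v _ _ => (hr v).2
  · intro L
    have := D.sum_map_one_sub_proj_le hω h1 h2 (S L)
    rw [← Finset.sum_congr rfl fun v _ => (hr v).1] at this
    exact_mod_cast this
  · intro L M h x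
    have e : ((∑ v ∈ S M, (ω (1 - D.proj v 1)).re - ∑ v ∈ S L, (ω (1 - D.proj v 1)).re : ℝ) : ℂ) =
        ∑ v ∈ S M \ S L, ω (1 - D.proj v 1) := by
      rw [← Finset.sum_sdiff (hS h), add_sub_cancel_right]
      push_cast
      exact Finset.sum_congr rfl fun v _ => (hr v).1
    rw [e]
    refine le_trans ?_ (D.map_one_sub_prod_le hω (S M \ S L))
    have hk := D.total_sub_total_mul_prod (hS h) x
    have p1 := D.total_mul_self (S M) x
    have p2 := D.total_mul_self (S L) x
    have p3 := D.prod_proj_mul_self (S M \ S L) (fun _ => 1)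
    have s1 := D.star_total (S M) x
    have s2 := D.star_total (S L) x
    have s3 := D.star_prod_proj (S M \ S L) (fun _ => 1)
    set E := D.total (S M) x
    set F := D.total (S L) x
    set Q := ∏ v ∈ S M \ S L, D.proj v 1
    refine le_of_projection_mul hω ?_ ?_ ?_ ?_ ?_
    · rw [star_pow, star_sub, s1, s2]
    · -- the square of the difference of two commuting projections is again a projection
      have e3 : (E - F) ^ 2 = E + F - 2 * (E * F) := by linear_combination p1 + p2
      rw [e3]
      linear_combination (1 - 4 * F + 4 * F * F) * p1 + (1 - 4 * E + 4 * E) * p2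
    · rw [star_sub, star_one, s3]
    · linear_combination p3
    · linear_combination (-(E - F)) * hk

lemma map_total_eq_one (hω : ∀ A, 0 ≤ ω (star A * A)) (h1 : ω 1 = 1) {κ : ι → X}
    (hκ : ∀ v, ω (D.proj v (κ v)) = 1) (S : Finset ι) : ω (D.total S (∏ v ∈ S, κ v)) = 1 := by
  classical
  have hP : ω (∏ v ∈ S, D.proj v (κ v)) = 1 := by
    induction S using Finset.induction_on with
    | empty => simpa using h1
    | insert v S hv ih =>
      rw [Finset.prod_insert hv, mul_comm,
        mul_of_map_eq_one hω h1 (D.star_proj _ _) (D.proj_mul_self _ _) (hκ v), ih]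
  rw [← mul_of_map_eq_one hω h1 (D.star_prod_proj S κ) (D.prod_proj_mul_self S κ) hP]
  have h := D.total_union_mul_prod κ (Finset.disjoint_empty_right S) (∏ v ∈ S, κ v)
  rw [Finset.union_empty, inv_mul_cancel, total_empty, if_pos rfl, one_mul] at h
  rw [h, hP]

/-- A region of non-trivial total charge contains a charged site, hence has energy at least one. -/
lemma map_one_le_sum (hω : ∀ A, 0 ≤ ω (star A * A)) {S : Finset ι} {x : X} (hx : x ≠ 1)
    (h : ∀ A, ω (A * D.total S x) = ω A) : ω 1 ≤ ∑ v ∈ S, ω (1 - D.proj v 1) := by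
  classical
  have h0 := D.total_union_mul_prod (fun _ => 1) (Finset.disjoint_empty_right S) x
  rw [Finset.union_empty, Finset.prod_const_one, inv_one, one_mul, total_empty, if_neg hx,
    zero_mul] at h0
  have h2 := D.map_one_sub_prod_le hω S
  rwa [map_sub, ← h (∏ v ∈ S, D.proj v 1), mul_comm, h0, map_zero, sub_zero] at h2

end ChargeFamily

noncomputable section

namespace QuantumDouble

variable {G : Type*} [CommGroup G] [Fintype G] [DecidableEq G]

/-! ### Orthogonality of characters -/

lemma norm_dual (χ : Dual G) (g : G) : ‖((χ g : ℂˣ) : ℂ)‖ = 1 := by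
  refine Complex.norm_eq_one_of_pow_eq_one (n := Fintype.card G) ?_ Fintype.card_ne_zero
  rw [← Units.val_pow_eq_pow_val, ← map_pow, pow_card_eq_one, map_one, Units.val_one]

lemma star_dual (χ : Dual G) (g : G) : star ((χ g : ℂˣ) : ℂ) = ((χ g⁻¹ : ℂˣ) : ℂ) := by
  rw [map_inv, Units.val_inv_eq_inv_val, Complex.star_def, Complex.inv_def,
    Complex.normSq_eq_norm_sq, norm_dual]
  simp

lemma sum_dual_apply (χ : Dual G) [Decidable (χ = 1)] :
    ∑ g : G, ((χ g : ℂˣ) : ℂ) = if χ = 1 then (Fintype.card G : ℂ) else 0 := by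
  split_ifs with h
  · simp [h]
  · refine sum_hom_units_eq_zero ((Units.coeHom ℂ).comp χ) fun h' => h ?_
    ext g
    simpa using DFunLike.congr_fun h' g

lemma card_dual : Fintype.card (Dual G) = Fintype.card G := by
  rw [← Nat.card_eq_fintype_card, ← Nat.card_eq_fintype_card]
  exact CommGroup.card_monoidHom_of_hasEnoughRootsOfUnity G ℂ

lemma sum_dual (g : G) :
    ∑ χ : Dual G, ((χ g : ℂˣ) : ℂ) = if g = 1 then (Fintype.card G : ℂ) else 0 := by
  split_ifs with h
  · simp [h, card_dual]
  · obtain ⟨φ, hφ⟩ := CommGroup.exists_apply_ne_one_of_hasEnoughRootsOfUnity G ℂ h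
    refine sum_hom_units_eq_zero
      ((Units.coeHom ℂ).comp (MonoidHom.eval g : Dual G →* ℂˣ)) fun h' => hφ ?_
    have := DFunLike.congr_fun h' φ
    simpa using this

lemma card_cast_ne_zero : (Fintype.card G : ℂ) ≠ 0 := Nat.cast_ne_zero.2 Fintype.card_ne_zero

/-! ### Operators that multiply and translate -/

/-- Two operators on `ℓ²(G^𝓑)` that agree on all vectors and configurations are equal. -/
lemma quasiLocal_ext {A B : QuasiLocal G}
    (h : ∀ (ψ : Hilb G) (c : Config G), (A : Hilb G →L[ℂ] Hilb G) ψ c =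
      (B : Hilb G →L[ℂ] Hilb G) ψ c) : A = B := by
  refine Subtype.ext ?_
  ext ψ c
  exact h ψ c

lemma mul_apply' (A B : QuasiLocal G) (ψ : Hilb G) (c : Config G) :
    ((A * B : QuasiLocal G) : Hilb G →L[ℂ] Hilb G) ψ c =
      (A : Hilb G →L[ℂ] Hilb G) ((B : Hilb G →L[ℂ] Hilb G) ψ) c := rfl

lemma smul_apply' (z : ℂ) (A : QuasiLocal G) (ψ : Hilb G) (c : Config G) :
    ((z • A : QuasiLocal G) : Hilb G →L[ℂ] Hilb G) ψ c =
      z * (A : Hilb G →L[ℂ] Hilb G) ψ c := rfl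

lemma one_apply' (ψ : Hilb G) (c : Config G) :
    ((1 : QuasiLocal G) : Hilb G →L[ℂ] Hilb G) ψ c = ψ c := rfl

lemma sum_apply' {ι : Type*} (s : Finset ι) (F : ι → QuasiLocal G) (ψ : Hilb G) (c : Config G) :
    ((∑ i ∈ s, F i : QuasiLocal G) : Hilb G →L[ℂ] Hilb G) ψ c =
      ∑ i ∈ s, (F i : Hilb G →L[ℂ] Hilb G) ψ c := by
  rw [← hilb_sum_apply, AddSubmonoidClass.coe_finsetSum]

lemma star_localObs (Λ : Finset Edge) (M : Matrix (Λ → G) (Λ → G) ℂ) :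
    star (localObs Λ M) = localObs Λ (star M) := Subtype.ext (map_star (localOp Λ) M).symm

lemma isLocal_localObs (Λ : Finset Edge) (M : Matrix (Λ → G) (Λ → G) ℂ) :
    IsLocal (localObs Λ M) := localOp_mem Λ M

/-- An operator that multiplies by a function and translates configurations commutes with `𝒜_Λ` if
neither the function nor the translation involves the edges in `Λ`. -/
lemma commute_localObs_of_apply {Λ : Finset Edge} {T : QuasiLocal G} {k : Config G → ℂ}
    {a : Config G}
    (hT : ∀ (ψ : Hilb G) (c : Config G), (T : Hilb G →L[ℂ] Hilb G) ψ c = k c * ψ (a * c))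
    (ha : ∀ e ∈ Λ, a e = 1) (hk : ∀ c b, k (glue Λ c b) = k c)
    (M : Matrix (Λ → G) (Λ → G) ℂ) : Commute T (localObs Λ M) := by
  refine quasiLocal_ext fun ψ c => ?_
  rw [mul_apply', mul_apply', hT, coe_localObs, localOp_apply, localOp_apply, Finset.mul_sum]
  have h1 : Λ.restrict (a * c) = Λ.restrict c := by
    funext e
    simp [ha e e.2]
  refine Finset.sum_congr rfl fun b _ => ?_
  have h2 : glue Λ (a * c) b = a * glue Λ c b := by
    funext e
    by_cases he : e ∈ Λ <;> simp [glue, he, ha]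
  rw [hT, hk, h1, h2]
  ring

/-! ### Star and plaquette operators -/

lemma Edge.src_ne_tgt (e : Edge) : Edge.src e ≠ Edge.tgt e := by
  obtain ⟨⟨x, y⟩, d⟩ := e
  cases d <;> simp [Edge.src, Edge.tgt]

lemma starShift_eq (v : ℤ × ℤ) (g : G) (e : Edge) : starShift v g e =
    (if Edge.src e = v then g else 1) * (if Edge.tgt e = v then g else 1)⁻¹ := by
  unfold starShift
  have := Edge.src_ne_tgt e
  split_ifs with h1 h2
  · exact absurd (h1.trans h2.symm) this
  all_goals simp

lemma starShift_mul (v : ℤ × ℤ) (g h : G) :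
    starShift v (g * h) = starShift v g * starShift v h := by
  funext e
  simp only [starShift, Pi.mul_apply]
  split_ifs
  · rfl
  · rw [mul_inv]
  · simp

lemma starShift_one (v : ℤ × ℤ) : starShift v (1 : G) = 1 := by
  funext e
  simp [starShift]

lemma starShift_inv (v : ℤ × ℤ) (g : G) : starShift v g⁻¹ = (starShift v g)⁻¹ := by
  rw [eq_inv_iff_mul_eq_one, ← starShift_mul, inv_mul_cancel, starShift_one]

lemma starOp_apply' (v : ℤ × ℤ) (g : G) (ψ : Hilb G) (c : Config G) :
    (starOp v g : Hilb G →L[ℂ] Hilb G) ψ c = ψ ((starShift v g)⁻¹ * c) := starOp_apply v g ψ c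

lemma starOp_mul (v : ℤ × ℤ) (g h : G) : starOp v g * starOp v h = starOp v (g * h) := by
  refine quasiLocal_ext fun ψ c => ?_
  rw [mul_apply', starOp_apply', starOp_apply', starOp_apply', starShift_mul, mul_inv,
    ← mul_assoc, mul_comm (starShift v h)⁻¹]

lemma starOp_one (v : ℤ × ℤ) : starOp v (1 : G) = 1 := by
  refine quasiLocal_ext fun ψ c => ?_
  rw [starOp_apply', starShift_one, inv_one, one_mul, one_apply']

lemma star_starOp (v : ℤ × ℤ) (g : G) : star (starOp v g) = starOp v g⁻¹ := by
  rw [starOp, starOp, star_localObs]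
  congr 1
  ext a b
  have h : (b = fun e : star4 v => starShift v g e * a e) ↔
      a = fun e : star4 v => starShift v g⁻¹ e * b e := by
    rw [starShift_inv]
    constructor <;> rintro rfl <;> funext e <;> simp
  simp only [Matrix.star_apply, Matrix.of_apply, h]
  split_ifs <;> simp

/-- The monodromy around the plaquette `f`, as a homomorphism on connections. -/
def holonomy (f : ℤ × ℤ) : Config G →* G where
  toFun c := c (f, true) * c (f + (0, 1), false) * (c (f + (1, 0), true))⁻¹ * (c (f, false))⁻¹
  map_one' := by simp
  map_mul' a b := by
    simp only [Pi.mul_apply, mul_inv]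
    ac_rfl

lemma holonomy_apply (f : ℤ × ℤ) (c : Config G) : holonomy f c =
    c (f, true) * c (f + (0, 1), false) * (c (f + (1, 0), true))⁻¹ * (c (f, false))⁻¹ := rfl

lemma plaqOp_apply' (f : ℤ × ℤ) (h : G) (ψ : Hilb G) (c : Config G) :
    (plaqOp f h : Hilb G →L[ℂ] Hilb G) ψ c = (if holonomy f c = h then 1 else 0) * ψ c :=
  plaqOp_apply f h ψ c

/-- Gauge transformations preserve the monodromies. -/
lemma holonomy_starShift (f v : ℤ × ℤ) (g : G) : holonomy f (starShift v g) = 1 := by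
  obtain ⟨i, hi⟩ : ∃ i : ℤ × ℤ → G, ∀ e, starShift v g e = i (Edge.src e) * (i (Edge.tgt e))⁻¹ :=
    ⟨fun u => if u = v then g else 1, fun e => starShift_eq v g e⟩
  have e : f + (0, 1) + (1, 0) = f + (1, 0) + (0, 1) := by abel
  simp only [holonomy_apply, hi, Edge.src, Edge.tgt, e, if_true, Bool.false_eq_true, if_false]
  group

lemma commute_starOp_plaqOp (v f : ℤ × ℤ) (g h : G) : Commute (starOp v g) (plaqOp f h) := by
  refine quasiLocal_ext fun ψ c => ?_
  rw [mul_apply', mul_apply', starOp_apply', plaqOp_apply', plaqOp_apply', starOp_apply',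
    map_mul, map_inv, holonomy_starShift, inv_one, one_mul]

lemma star_plaqOp (f : ℤ × ℤ) (h : G) : star (plaqOp f h) = plaqOp f h := by
  rw [plaqOp, star_localObs, Matrix.star_eq_conjTranspose, Matrix.diagonal_conjTranspose]
  congr 2
  funext b
  rw [Pi.star_apply]
  split_ifs <;> simp

lemma plaqOp_mul (f : ℤ × ℤ) (h k : G) :
    plaqOp f h * plaqOp f k = if h = k then plaqOp f h else 0 := by
  refine quasiLocal_ext fun ψ c => ?_
  rw [mul_apply', plaqOp_apply', plaqOp_apply']
  split_ifs with h1 h2 h3 h3 h2 h3 <;>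
    simp only [plaqOp_apply', ZeroMemClass.coe_zero, _root_.zero_apply] <;> simp_all

lemma sum_plaqOp (f : ℤ × ℤ) : ∑ h : G, plaqOp f h = 1 := by
  refine quasiLocal_ext fun ψ c => ?_
  rw [sum_apply', one_apply']
  simp [plaqOp_apply']

/-! ### The electric projections -/

lemma star_electricProj (v : ℤ × ℤ) (χ : Dual G) : star (electricProj v χ) = electricProj v χ := by
  rw [electricProj, star_smul, star_sum, star_inv₀, star_natCast]
  congr 1
  refine Fintype.sum_equiv (Equiv.inv G) _ _ fun g => ?_
  rw [star_smul, star_star, star_starOp, Equiv.inv_apply, star_dual, inv_inv]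

lemma electricProj_mul_starOp (v : ℤ × ℤ) (χ : Dual G) (h : G) :
    electricProj v χ * starOp v h = ((χ h : ℂˣ) : ℂ) • electricProj v χ := by
  rw [electricProj, smul_mul_assoc, Finset.sum_mul, smul_comm ((χ h : ℂˣ) : ℂ)]
  congr 1
  rw [Finset.smul_sum]
  refine Fintype.sum_equiv (Equiv.mulRight h) _ _ fun g => ?_
  rw [Equiv.coe_mulRight, smul_mul_assoc, starOp_mul, smul_smul, star_dual, star_dual, mul_inv,
    map_mul, Units.val_mul, mul_left_comm, ← Units.val_mul, ← map_mul χ, mul_inv_cancel, map_one,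
    Units.val_one, mul_one]

lemma electricProj_mul (v : ℤ × ℤ) (χ ξ : Dual G) [Decidable (χ = ξ)] :
    electricProj v χ * electricProj v ξ = if χ = ξ then electricProj v χ else 0 := by
  classical
  have e : electricProj v χ * electricProj v ξ = ((Fintype.card G : ℂ)⁻¹ *
      ∑ g : G, (((χ * ξ⁻¹) g : ℂˣ) : ℂ)) • electricProj v χ := by
    rw [mul_smul, Finset.sum_smul]
    conv_lhs => arg 2; rw [electricProj]
    rw [mul_smul_comm, Finset.mul_sum]
    congr 1
    refine Finset.sum_congr rfl fun g _ => ?_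
    rw [mul_smul_comm, electricProj_mul_starOp, smul_smul, star_dual, mul_comm, map_inv]
    rfl
  rw [e, sum_dual_apply]
  by_cases h : χ = ξ
  · rw [if_pos h, if_pos (mul_inv_eq_one.2 h), inv_mul_cancel₀ card_cast_ne_zero, one_smul]
  · rw [if_neg h, if_neg (fun h' => h (mul_inv_eq_one.1 h')), mul_zero, zero_smul]

lemma sum_electricProj (v : ℤ × ℤ) : ∑ χ : Dual G, electricProj v χ = 1 := by
  simp only [electricProj]
  rw [← Finset.smul_sum, Finset.sum_comm]
  have h : ∀ g : G, ∑ χ : Dual G, star ((χ g : ℂˣ) : ℂ) • starOp v g =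
      if g = 1 then (Fintype.card G : ℂ) • 1 else 0 := by
    intro g
    rw [← Finset.sum_smul, ← star_sum, sum_dual]
    split_ifs with hg
    · rw [hg, starOp_one, star_natCast]
    · rw [star_zero, zero_smul]
  simp only [h, Finset.sum_ite_eq', Finset.mem_univ, if_true]
  rw [smul_smul, inv_mul_cancel₀ card_cast_ne_zero, one_smul]

lemma electricProj_one (v : ℤ × ℤ) : electricProj v 1 = starTerm G v := by
  simp [electricProj, starTerm]

lemma commute_electricProj_plaqOp (v f : ℤ × ℤ) (χ : Dual G) (h : G) :
    Commute (electricProj v χ) (plaqOp f h) :=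
  (Commute.sum_left _ _ _ fun g _ => (commute_starOp_plaqOp v f g h).smul_left _).smul_left _

/-! ### The algebra of charges -/

variable (G) in
/-- The commutative star algebra generated by all the electric and magnetic charge projections. -/
def chargeAlgebra : StarSubalgebra ℂ (QuasiLocal G) :=
  StarAlgebra.adjoin ℂ (Set.range (fun p : (ℤ × ℤ) × Dual G => electricProj p.1 p.2) ∪
    Set.range (fun p : (ℤ × ℤ) × G => plaqOp p.1 p.2))

lemma electricProj_mem (v : ℤ × ℤ) (χ : Dual G) : electricProj v χ ∈ chargeAlgebra G :=
  StarAlgebra.subset_adjoin ℂ _ (Or.inl ⟨(v, χ), rfl⟩)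

lemma plaqOp_mem (f : ℤ × ℤ) (c : G) : plaqOp f c ∈ chargeAlgebra G :=
  StarAlgebra.subset_adjoin ℂ _ (Or.inr ⟨(f, c), rfl⟩)

lemma isMulCommutative_chargeAlgebra : IsMulCommutative (chargeAlgebra G) := by
  have h : ∀ x ∈ Set.range (fun p : (ℤ × ℤ) × Dual G => electricProj p.1 p.2) ∪
      Set.range (fun p : (ℤ × ℤ) × G => plaqOp p.1 p.2), star x = x ∧
      ∀ y ∈ Set.range (fun p : (ℤ × ℤ) × Dual G => electricProj p.1 p.2) ∪
        Set.range (fun p : (ℤ × ℤ) × G => plaqOp p.1 p.2), x * y = y * x := by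
    rintro _ (⟨p, rfl⟩ | ⟨p, rfl⟩)
    · refine ⟨star_electricProj _ _, ?_⟩
      rintro _ (⟨q, rfl⟩ | ⟨q, rfl⟩)
      · exact commute_electricProj _ _ _ _
      · exact commute_electricProj_plaqOp _ _ _ _
    · refine ⟨star_plaqOp _ _, ?_⟩
      rintro _ (⟨q, rfl⟩ | ⟨q, rfl⟩)
      · exact (commute_electricProj_plaqOp _ _ _ _).symm
      · exact commute_plaqOp _ _ _ _
  refine StarAlgebra.isMulCommutative_adjoin ℂ (fun x hx y hy => (h x hx).2 y hy)
    (fun x hx y hy => ?_)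
  rw [(h y hy).1]
  exact (h x hx).2 y hy

instance : CommRing (chargeAlgebra G) :=
  { (inferInstance : Ring (chargeAlgebra G)) with
    mul_comm := isMulCommutative_chargeAlgebra.is_comm.comm }

variable (G) in
/-- The electric charges on the vertices of the lattice. -/
def electricFamily : ChargeFamily (chargeAlgebra G) (ℤ × ℤ) (Dual G) where
  proj v χ := ⟨electricProj v χ, electricProj_mem v χ⟩
  star_proj v χ := Subtype.ext (star_electricProj v χ)
  proj_mul_self v χ := by
    classical
    exact Subtype.ext ((electricProj_mul v χ χ).trans (if_pos rfl))
  proj_mul_of_ne v χ ξ h := by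
    classical
    exact Subtype.ext ((electricProj_mul v χ ξ).trans (if_neg h))
  sum_proj v := Subtype.ext (by
    rw [AddSubmonoidClass.coe_finsetSum]
    exact sum_electricProj v)

variable (G) in
/-- The magnetic charges on the faces of the lattice. -/
def magneticFamily : ChargeFamily (chargeAlgebra G) (ℤ × ℤ) G where
  proj f c := ⟨plaqOp f c, plaqOp_mem f c⟩
  star_proj f c := Subtype.ext (star_plaqOp f c)
  proj_mul_self f c := Subtype.ext ((plaqOp_mul f c c).trans (if_pos rfl))
  proj_mul_of_ne f c d h := Subtype.ext ((plaqOp_mul f c d).trans (if_neg h))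
  sum_proj f := Subtype.ext (by
    rw [AddSubmonoidClass.coe_finsetSum]
    exact sum_plaqOp f)

/-- A product over a finite set in the algebra of charges, computed in the quasi-local algebra. -/
lemma coe_prod_chargeAlgebra {ι : Type*} (s : Finset ι) (F : ι → chargeAlgebra G)
    (h : (s : Set ι).Pairwise (Function.onFun Commute fun i => (F i : QuasiLocal G))) :
    ((∏ i ∈ s, F i : chargeAlgebra G) : QuasiLocal G) =
      s.noncommProd (fun i => (F i : QuasiLocal G)) h := by
  rw [← Finset.noncommProd_eq_prod]
  exact Finset.map_noncommProd s F _ (chargeAlgebra G).subtype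

lemma coe_electricFamily_total (L : ℕ) (χ : Dual G) :
    (((electricFamily G).total (starsIn L) χ : chargeAlgebra G) : QuasiLocal G) =
      globalElectric L χ := by
  classical
  rw [ChargeFamily.total_eq_sum, globalElectric, AddSubmonoidClass.coe_finsetSum]
  refine Finset.sum_congr (by congr) fun κ _ => ?_
  exact coe_prod_chargeAlgebra _ _ _

lemma coe_magneticFamily_total (L : ℕ) (c : G) :
    (((magneticFamily G).total (plaqsIn L) c : chargeAlgebra G) : QuasiLocal G) =
      globalMagnetic L c := by
  classical
  rw [ChargeFamily.total_eq_sum, globalMagnetic, AddSubmonoidClass.coe_finsetSum]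
  refine Finset.sum_congr (by congr) fun κ _ => ?_
  exact coe_prod_chargeAlgebra _ _ _

lemma coe_hamiltonian (L : ℕ) :
    ((∑ v ∈ starsIn L, (1 - (electricFamily G).proj v 1) +
      ∑ f ∈ plaqsIn L, (1 - (magneticFamily G).proj f 1) : chargeAlgebra G) : QuasiLocal G) =
      hamiltonian G L := by
  rw [hamiltonian]
  push_cast
  simp only [← electricProj_one]
  rfl

/-! ### Transport of charges -/

lemma IsLocal.mul {A B : QuasiLocal G} (hA : IsLocal A) (hB : IsLocal B) : IsLocal (A * B) :=
  mul_mem hA hB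

lemma IsLocal.star {A : QuasiLocal G} (hA : IsLocal A) : IsLocal (star A) :=
  star_mem hA

/-- `U` is a local unitary that moves a charge `x` of the family `D` from `v` to `w`, and leaves
the charges of the family `D'` alone. -/
structure IsTransport {X Y : Type*} [CommGroup X] [Fintype X] [Fintype Y]
    (D : ChargeFamily (chargeAlgebra G) (ℤ × ℤ) X) (D' : ChargeFamily (chargeAlgebra G) (ℤ × ℤ) Y)
    (x : X) (v w : ℤ × ℤ) (U : QuasiLocal G) : Prop where
  isLocal : IsLocal U
  star_mul_self : star U * U = 1
  mul_star_self : U * star U = 1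
  proj_mul : ∀ u y, (D.proj u y : QuasiLocal G) * U =
    U * (D.proj u (y * (Pi.mulSingle v x * (Pi.mulSingle w x)⁻¹ : ℤ × ℤ → X) u) : QuasiLocal G)
  commute : ∀ u y, Commute (D'.proj u y : QuasiLocal G) U

/-- Any two sites of `ℤ²` are joined by steps to neighbours. -/
lemma rel_of_neighbours {r : ℤ × ℤ → ℤ × ℤ → Prop} (hr : Equivalence r)
    (h1 : ∀ v, r v (v + (1, 0))) (h2 : ∀ v, r v (v + (0, 1))) (v w : ℤ × ℤ) : r v w := by
  have e1 : ∀ (y x : ℤ), r (0, y) (x, y) := by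
    intro y x
    induction x using Int.induction_on with
    | zero => exact hr.refl _
    | succ i ih => exact hr.trans ih (by simpa using h1 ((i : ℤ), y))
    | pred i ih => exact hr.trans ih (hr.symm (by simpa using h1 (-(i : ℤ) - 1, y)))
  have e2 : ∀ y : ℤ, r (0, 0) (0, y) := by
    intro y
    induction y using Int.induction_on with
    | zero => exact hr.refl _
    | succ i ih => exact hr.trans ih (by simpa using h2 (0, (i : ℤ)))
    | pred i ih => exact hr.trans ih (hr.symm (by simpa using h2 (0, -(i : ℤ) - 1)))
  have e3 : ∀ u : ℤ × ℤ, r (0, 0) u := fun u => hr.trans (e2 u.2) (e1 u.2 u.1)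
  exact hr.trans (hr.symm (e3 v)) (e3 w)

section Transport

variable {X Y : Type*} [CommGroup X] [Fintype X] [Fintype Y]
  {D : ChargeFamily (chargeAlgebra G) (ℤ × ℤ) X} {D' : ChargeFamily (chargeAlgebra G) (ℤ × ℤ) Y}

lemma IsTransport.refl (x : X) (v : ℤ × ℤ) : IsTransport D D' x v v (1 : QuasiLocal G) where
  isLocal := one_mem (localAlgebra G)
  star_mul_self := by simp
  mul_star_self := by simp
  proj_mul u y := by simp
  commute u y := Commute.one_right _

lemma IsTransport.symm {x : X} {v w : ℤ × ℤ} {U : QuasiLocal G} (h : IsTransport D D' x v w U) :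
    IsTransport D D' x w v (star U) where
  isLocal := h.isLocal.star
  star_mul_self := by rw [star_star, h.mul_star_self]
  mul_star_self := by rw [star_star, h.star_mul_self]
  proj_mul u y := by
    have e := congrArg star (h.proj_mul u
      (y * (Pi.mulSingle w x * (Pi.mulSingle v x)⁻¹ : ℤ × ℤ → X) u))
    have e2 : y * (Pi.mulSingle w x * (Pi.mulSingle v x)⁻¹ : ℤ × ℤ → X) u *
        (Pi.mulSingle v x * (Pi.mulSingle w x)⁻¹ : ℤ × ℤ → X) u = y := by
      simp only [Pi.mul_apply, Pi.inv_apply]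
      group
    rw [e2, star_mul, star_mul, ← StarMemClass.coe_star, ← StarMemClass.coe_star, D.star_proj,
      D.star_proj] at e
    exact e.symm
  commute u y := by
    have e := (h.commute u y).star_star
    rwa [← StarMemClass.coe_star, D'.star_proj] at e

lemma IsTransport.trans {x : X} {v w z : ℤ × ℤ} {U V : QuasiLocal G}
    (h : IsTransport D D' x v w U) (h' : IsTransport D D' x w z V) :
    IsTransport D D' x v z (U * V) where
  isLocal := h.isLocal.mul h'.isLocal
  star_mul_self := by
    rw [star_mul, mul_assoc, ← mul_assoc (star U), h.star_mul_self, one_mul, h'.star_mul_self]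
  mul_star_self := by
    rw [star_mul, mul_assoc, ← mul_assoc V, h'.mul_star_self, one_mul, h.mul_star_self]
  proj_mul u y := by
    have e : y * (Pi.mulSingle v x * (Pi.mulSingle w x)⁻¹ : ℤ × ℤ → X) u *
        (Pi.mulSingle w x * (Pi.mulSingle z x)⁻¹ : ℤ × ℤ → X) u =
        y * (Pi.mulSingle v x * (Pi.mulSingle z x)⁻¹ : ℤ × ℤ → X) u := by
      simp only [Pi.mul_apply, Pi.inv_apply]
      group
    rw [← mul_assoc, h.proj_mul, mul_assoc, h'.proj_mul, e, mul_assoc]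
  commute u y := (h.commute u y).mul_right (h'.commute u y)

lemma exists_isTransport_of_neighbours (x : X)
    (h1 : ∀ v : ℤ × ℤ, ∃ U : QuasiLocal G, IsTransport D D' x v (v + (1, 0)) U)
    (h2 : ∀ v : ℤ × ℤ, ∃ U : QuasiLocal G, IsTransport D D' x v (v + (0, 1)) U)
    (v w : ℤ × ℤ) : ∃ U : QuasiLocal G, IsTransport D D' x v w U := by
  refine rel_of_neighbours (r := fun v w => ∃ U : QuasiLocal G, IsTransport D D' x v w U)
    ⟨fun v => ⟨1, .refl x v⟩, ?_, ?_⟩ h1 h2 v w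
  · rintro v w ⟨U, hU⟩
    exact ⟨_, hU.symm⟩
  · rintro v w z ⟨U, hU⟩ ⟨V, hV⟩
    exact ⟨_, hU.trans hV⟩

end Transport

/-- The operator that multiplies by the value of the character `χ` at the label of `e`. -/
def edgePhase (e : Edge) (χ : Dual G) : QuasiLocal G :=
  localObs {e} (Matrix.diagonal fun b => ((χ (b ⟨e, Finset.mem_singleton_self e⟩) : ℂˣ) : ℂ))

lemma edgePhase_apply (e : Edge) (χ : Dual G) (ψ : Hilb G) (c : Config G) :
    (edgePhase e χ : Hilb G →L[ℂ] Hilb G) ψ c = ((χ (c e) : ℂˣ) : ℂ) * ψ c := by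
  rw [edgePhase, coe_localObs, localOp_apply]
  simp [Matrix.diagonal_apply, glue_restrict]

lemma star_edgePhase (e : Edge) (χ : Dual G) : star (edgePhase e χ) = edgePhase e χ⁻¹ := by
  rw [edgePhase, star_localObs, Matrix.star_eq_conjTranspose, Matrix.diagonal_conjTranspose]
  congr 2
  funext b
  rw [Pi.star_apply, star_dual, map_inv]
  rfl

lemma edgePhase_mul (e : Edge) (χ ξ : Dual G) : edgePhase e χ * edgePhase e ξ =
    edgePhase e (χ * ξ) := by
  refine quasiLocal_ext fun ψ c => ?_
  rw [mul_apply', edgePhase_apply, edgePhase_apply, edgePhase_apply, MonoidHom.mul_apply,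
    Units.val_mul, mul_assoc]

lemma edgePhase_one (e : Edge) : edgePhase e (1 : Dual G) = 1 := by
  refine quasiLocal_ext fun ψ c => ?_
  rw [edgePhase_apply, one_apply', MonoidHom.one_apply, Units.val_one, one_mul]

lemma starOp_mul_edgePhase (u : ℤ × ℤ) (g : G) (e : Edge) (χ : Dual G) :
    starOp u g * edgePhase e χ =
      ((χ (starShift u g e)⁻¹ : ℂˣ) : ℂ) • (edgePhase e χ * starOp u g) := by
  refine quasiLocal_ext fun ψ c => ?_
  rw [mul_apply', starOp_apply', edgePhase_apply, smul_apply', mul_apply', edgePhase_apply,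
    starOp_apply', Pi.mul_apply, map_mul, Units.val_mul, mul_assoc]
  rfl

/-- The phase operator of an edge moves an electric charge along the edge. -/
lemma isTransport_edgePhase (e : Edge) (χ : Dual G) : IsTransport (electricFamily G)
    (magneticFamily G) χ (Edge.src e) (Edge.tgt e) (edgePhase e χ) where
  isLocal := isLocal_localObs _ _
  star_mul_self := by
    rw [star_edgePhase, edgePhase_mul]
    exact (congrArg _ (inv_mul_cancel χ)).trans (edgePhase_one e)
  mul_star_self := by
    rw [star_edgePhase, edgePhase_mul]
    exact (congrArg _ (mul_inv_cancel χ)).trans (edgePhase_one e)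
  proj_mul u ξ := by
    change electricProj u ξ * edgePhase e χ = edgePhase e χ * electricProj u _
    rw [electricProj, electricProj, smul_mul_assoc, mul_smul_comm, Finset.sum_mul, Finset.mul_sum]
    congr 1
    refine Finset.sum_congr rfl fun g _ => ?_
    rw [smul_mul_assoc, starOp_mul_edgePhase, smul_smul, mul_smul_comm]
    congr 1
    have h : ((Pi.mulSingle (Edge.src e) χ * (Pi.mulSingle (Edge.tgt e) χ)⁻¹ :
        ℤ × ℤ → Dual G) u) g = χ (starShift u g e) := by
      rw [starShift_eq, Pi.mul_apply, Pi.inv_apply, Pi.mulSingle_apply, Pi.mulSingle_apply, map_mul,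
        map_inv, MonoidHom.mul_apply, MonoidHom.inv_apply]
      simp only [eq_comm (a := u)]
      congr 1
      · split_ifs <;> simp
      · split_ifs <;> simp
    rw [MonoidHom.mul_apply, h, Units.val_mul, star_mul, star_dual χ, mul_comm]
  commute f c := by
    refine quasiLocal_ext fun ψ b => ?_
    change ((plaqOp f c * edgePhase e χ : QuasiLocal G) : Hilb G →L[ℂ] Hilb G) ψ b =
      ((edgePhase e χ * plaqOp f c : QuasiLocal G) : Hilb G →L[ℂ] Hilb G) ψ b
    rw [mul_apply', mul_apply', edgePhase_apply, plaqOp_apply', plaqOp_apply', edgePhase_apply,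
      mul_left_comm]

lemma exists_isTransport_electric (χ : Dual G) (v w : ℤ × ℤ) :
    ∃ U : QuasiLocal G, IsTransport (electricFamily G) (magneticFamily G) χ v w U :=
  exists_isTransport_of_neighbours χ (fun v => ⟨_, isTransport_edgePhase (v, false) χ⟩)
    (fun v => ⟨_, isTransport_edgePhase (v, true) χ⟩) v w

/-- The operator that multiplies the label of `e` by `h`. -/
def edgeShift (e : Edge) (h : G) : QuasiLocal G :=
  localObs {e} (Matrix.of fun a b => if a = (fun i => h * b i) then 1 else 0)

lemma edgeShift_apply (e : Edge) (h : G) (ψ : Hilb G) (c : Config G) :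
    (edgeShift e h : Hilb G →L[ℂ] Hilb G) ψ c = ψ (Pi.mulSingle e h⁻¹ * c) := by
  rw [edgeShift, coe_localObs, localOp_apply]
  have key : ∀ a : ({e} : Finset Edge) → G,
      (({e} : Finset Edge).restrict c = fun i => h * a i) ↔
        a = fun i : ({e} : Finset Edge) => h⁻¹ * c i := by
    intro a
    simp only [funext_iff, Finset.restrict]
    exact forall_congr' fun i =>
      ⟨fun h' => by rw [h', inv_mul_cancel_left], fun h' => by rw [h', mul_inv_cancel_left]⟩
  simp only [Matrix.of_apply, key, ite_mul, one_mul, zero_mul, Finset.sum_ite_eq',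
    Finset.mem_univ, if_true]
  refine congrArg (ψ : Config G → ℂ) ?_
  funext i
  by_cases hi : i = e
  · subst hi
    simp [glue]
  · simp [glue, hi]

lemma star_edgeShift (e : Edge) (h : G) : star (edgeShift e h) = edgeShift e h⁻¹ := by
  rw [edgeShift, edgeShift, star_localObs]
  congr 1
  ext a b
  have h' : (b = fun i => h * a i) ↔ a = fun i => h⁻¹ * b i := by
    constructor <;> rintro rfl <;> funext e <;> simp
  simp only [Matrix.star_apply, Matrix.of_apply, h']
  split_ifs <;> simp

lemma edgeShift_mul_inv (e : Edge) (h : G) : edgeShift e h * edgeShift e h⁻¹ = 1 := by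
  refine quasiLocal_ext fun ψ c => ?_
  rw [mul_apply', edgeShift_apply, edgeShift_apply, one_apply', ← mul_assoc, ← Pi.mulSingle_mul,
    inv_inv, mul_inv_cancel, Pi.mulSingle_one, one_mul]

/-- The shift operator of an edge moves a magnetic charge between the two faces at the edge; the faces
and the sign are read off from the monodromies of the shift. -/
lemma isTransport_edgeShift (e : Edge) (h x : G) (v w : ℤ × ℤ)
    (hvw : ∀ u, holonomy u (Pi.mulSingle e h⁻¹) =
      (Pi.mulSingle v x * (Pi.mulSingle w x)⁻¹ : ℤ × ℤ → G) u) :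
    IsTransport (magneticFamily G) (electricFamily G) x v w (edgeShift e h) where
  isLocal := isLocal_localObs _ _
  star_mul_self := by
    have := edgeShift_mul_inv e h⁻¹
    rwa [inv_inv, ← star_edgeShift] at this
  mul_star_self := by rw [star_edgeShift, edgeShift_mul_inv]
  proj_mul u y := by
    refine quasiLocal_ext fun ψ c => ?_
    change ((plaqOp u y * edgeShift e h : QuasiLocal G) : Hilb G →L[ℂ] Hilb G) ψ c =
      ((edgeShift e h * plaqOp u _ : QuasiLocal G) : Hilb G →L[ℂ] Hilb G) ψ c
    rw [mul_apply', mul_apply', edgeShift_apply, plaqOp_apply', plaqOp_apply', edgeShift_apply,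
      ← hvw, map_mul, mul_comm y]
    simp only [mul_right_inj]
  commute u χ := by
    have h1 : ∀ g, Commute (starOp u g) (edgeShift e h) := by
      intro g
      refine quasiLocal_ext fun ψ c => ?_
      rw [mul_apply', mul_apply', edgeShift_apply, starOp_apply', starOp_apply', edgeShift_apply,
        mul_left_comm]
    exact (Commute.sum_left _ _ _ fun g _ => (h1 g).smul_left _).smul_left _

lemma exists_isTransport_magnetic (x : G) (v w : ℤ × ℤ) :
    ∃ U : QuasiLocal G, IsTransport (magneticFamily G) (electricFamily G) x v w U := by
  -- the faces `v` and `v + (1, 0)` share the vertical edge at `v + (1, 0)`, the faces `v` and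
  -- `v + (0, 1)` the horizontal edge at `v + (0, 1)`, with the opposite orientation
  refine exists_isTransport_of_neighbours x
    (fun v => ⟨edgeShift (v + (1, 0), true) x, isTransport_edgeShift _ _ _ _ _ fun u => ?_⟩)
    (fun v => ⟨edgeShift (v + (0, 1), false) x⁻¹, isTransport_edgeShift _ _ _ _ _ fun u => ?_⟩) v w
  · simp only [holonomy_apply, Pi.mul_apply, Pi.inv_apply, Pi.mulSingle_apply, Prod.mk.injEq,
      add_left_inj]
    split_ifs <;> simp_all
  · simp only [holonomy_apply, Pi.mul_apply, Pi.inv_apply, Pi.mulSingle_apply, Prod.mk.injEq,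
      add_left_inj]
    split_ifs <;> simp_all

/-! ### Electric and magnetic charges as instances of one model -/

/-- The common features of the electric charges (`D`, on the vertices, with `D'` the magnetic ones)
and of the magnetic charges (`D`, on the faces, with `D'` the electric ones): the energy counts
charges, charges can be moved by local unitaries, and the total charge of a large box is
measured at its boundary. -/
structure IsChargeModel {X Y : Type*} [CommGroup X] [Fintype X] [CommGroup Y] [Fintype Y]
    (D : ChargeFamily (chargeAlgebra G) (ℤ × ℤ) X) (D' : ChargeFamily (chargeAlgebra G) (ℤ × ℤ) Y)
    (S S' : ℕ → Finset (ℤ × ℤ)) : Prop where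
  mono : Monotone S
  eventually_mem : ∀ v, ∀ᶠ L in atTop, v ∈ S L
  hamiltonian_eq : ∀ L, hamiltonian G L =
    ((∑ v ∈ S L, (1 - D.proj v 1) + ∑ f ∈ S' L, (1 - D'.proj f 1) : chargeAlgebra G) : QuasiLocal G)
  exists_isTransport : ∀ x v w, ∃ U : QuasiLocal G, IsTransport D D' x v w U
  isLocal_proj : ∀ v x, IsLocal (D.proj v x : QuasiLocal G)
  eventually_commute : ∀ A : QuasiLocal G, IsLocal A → ∀ᶠ L in atTop, ∀ x,
    Commute (D.total (S L) x : QuasiLocal G) A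

lemma starsIn_monotone : Monotone starsIn := fun _ _ h => starsIn_mono h

lemma plaqsIn_monotone : Monotone plaqsIn := fun _ _ h => plaqsIn_mono h

lemma eventually_mem_starsIn (v : ℤ × ℤ) : ∀ᶠ L in atTop, v ∈ starsIn L := by
  obtain ⟨L, hL⟩ := exists_edgeBox (star4 v)
  filter_upwards [eventually_ge_atTop (L + 1)] with M hM
  refine starsIn_mono hM ?_
  by_contra h
  exact Finset.disjoint_left.1 (star_disjoint h) (by simp [star4] : (v, false) ∈ star4 v)
    (hL (by simp [star4]))

lemma eventually_mem_plaqsIn (f : ℤ × ℤ) : ∀ᶠ L in atTop, f ∈ plaqsIn L := by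
  obtain ⟨L, hL⟩ := exists_edgeBox (plaq4 f)
  filter_upwards [eventually_ge_atTop (L + 1)] with M hM
  refine plaqsIn_mono hM ?_
  by_contra h
  exact Finset.disjoint_left.1 (plaq_disjoint h) (by simp [plaq4] : (f, false) ∈ plaq4 f)
    (hL (by simp [plaq4]))

lemma isLocal_electricProj (v : ℤ × ℤ) (χ : Dual G) : IsLocal (electricProj v χ) := by
  have h : electricProj v χ ∈ (localAlgebra G).comap (localAlgebra G).topologicalClosure.subtype :=
    SMulMemClass.smul_mem _ (sum_mem fun g _ => SMulMemClass.smul_mem _ (isLocal_localObs _ _))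
  exact h

/-- The total electric charge of a region is measured by a global gauge transformation of the
region. -/
lemma coe_electricFamily_total_eq_sum (S : Finset (ℤ × ℤ)) :
    ∃ W : G → QuasiLocal G,
      (∀ g ψ c, (W g : Hilb G →L[ℂ] Hilb G) ψ c = ψ ((∏ v ∈ S, starShift v g)⁻¹ * c)) ∧
      ∀ χ, ((electricFamily G).total S χ : QuasiLocal G) =
        (Fintype.card G : ℂ)⁻¹ • ∑ g, star ((χ g : ℂˣ) : ℂ) • W g := by
  classical
  induction S using Finset.induction_on with
  | empty =>
    refine ⟨fun _ => 1, fun g ψ c => by simp, fun χ => ?_⟩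
    rw [ChargeFamily.total_empty, ← Finset.sum_smul, ← star_sum, sum_dual_apply, smul_smul]
    split_ifs
    · rw [star_natCast, inv_mul_cancel₀ card_cast_ne_zero, one_smul]; rfl
    · simp
  | insert v S hv ih =>
    obtain ⟨W, hW, hE⟩ := ih
    refine ⟨fun g => starOp v g * W g, fun g ψ c => ?_, fun χ => ?_⟩
    · rw [mul_apply', starOp_apply', hW, Finset.prod_insert hv, mul_inv_rev, mul_assoc]
    · have e : (((electricFamily G).total (insert v S) χ : chargeAlgebra G) : QuasiLocal G) =
          ∑ ξ : Dual G, electricProj v ξ * ((electricFamily G).total S (ξ⁻¹ * χ) : QuasiLocal G) := by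
        rw [ChargeFamily.total_insert _ hv, AddSubmonoidClass.coe_finsetSum]
        rfl
      have e2 : ∀ ξ : Dual G, electricProj v ξ *
          ((electricFamily G).total S (ξ⁻¹ * χ) : QuasiLocal G) =
          ((Fintype.card G : ℂ)⁻¹ * (Fintype.card G : ℂ)⁻¹) • ∑ h, ∑ g,
            (((ξ (g⁻¹ * h) : ℂˣ) : ℂ) * star ((χ h : ℂˣ) : ℂ)) • (starOp v g * W h) := by
        intro ξ
        rw [hE, electricProj, smul_mul_assoc, mul_smul_comm, smul_smul]
        congr 1
        rw [Finset.sum_mul_sum, Finset.sum_comm]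
        refine Finset.sum_congr rfl fun h _ => Finset.sum_congr rfl fun g _ => ?_
        rw [smul_mul_smul_comm]
        congr 1
        rw [MonoidHom.mul_apply, MonoidHom.inv_apply, Units.val_mul, star_mul, star_dual ξ,
          ← map_inv, star_dual ξ, inv_inv, map_mul, Units.val_mul]
        ring
      -- summed over `ξ`, only the terms with `g = h` survive
      have e3 : ∀ h g : G, ∑ ξ : Dual G, (((ξ (g⁻¹ * h) : ℂˣ) : ℂ) * star ((χ h : ℂˣ) : ℂ)) •
          (starOp v g * W h) = if g = h then
            (Fintype.card G : ℂ) • star ((χ h : ℂˣ) : ℂ) • (starOp v h * W h) else 0 := by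
        intro h g
        rw [← Finset.sum_smul, ← Finset.sum_mul, sum_dual]
        by_cases hg : g = h
        · rw [if_pos hg, hg, inv_mul_cancel, if_pos rfl, mul_smul]
        · rw [if_neg hg, if_neg (fun h' => hg (inv_mul_eq_one.1 h')), zero_mul, zero_smul]
      rw [e, Finset.sum_congr rfl fun ξ _ => e2 ξ, ← Finset.smul_sum, Finset.sum_comm]
      have e4 : ∀ h : G, ∑ ξ : Dual G, ∑ g : G,
          (((ξ (g⁻¹ * h) : ℂˣ) : ℂ) * star ((χ h : ℂˣ) : ℂ)) • (starOp v g * W h) =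
          (Fintype.card G : ℂ) • star ((χ h : ℂˣ) : ℂ) • (starOp v h * W h) := by
        intro h
        rw [Finset.sum_comm, Finset.sum_congr rfl fun g _ => e3 h g]
        simp
      rw [Finset.sum_congr rfl fun h _ => e4 h, ← Finset.smul_sum, smul_smul, mul_assoc,
        inv_mul_cancel₀ card_cast_ne_zero, mul_one]

/-- The total magnetic charge of a region is the product of its monodromies. -/
lemma coe_magneticFamily_total_apply (S : Finset (ℤ × ℤ)) (x : G) (ψ : Hilb G) (c : Config G) :
    (((magneticFamily G).total S x : QuasiLocal G) : Hilb G →L[ℂ] Hilb G) ψ c =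
      (if (∏ f ∈ S, holonomy f) c = x then 1 else 0) * ψ c := by
  classical
  induction S using Finset.induction_on generalizing x with
  | empty =>
    rw [ChargeFamily.total_empty, Finset.prod_empty, MonoidHom.one_apply]
    by_cases h : x = 1
    · rw [if_pos h, if_pos h.symm, one_mul]; rfl
    · rw [if_neg h, if_neg (Ne.symm h), zero_mul]; rfl
  | insert f S hf ih =>
    have e : (((magneticFamily G).total (insert f S) x : chargeAlgebra G) : QuasiLocal G) =
        ∑ y : G, plaqOp f y * ((magneticFamily G).total S (y⁻¹ * x) : QuasiLocal G) := by
      rw [ChargeFamily.total_insert _ hf, AddSubmonoidClass.coe_finsetSum]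
      rfl
    rw [e, sum_apply', Finset.sum_eq_single (holonomy f c)]
    · rw [mul_apply', plaqOp_apply', ih, if_pos rfl, one_mul, Finset.prod_insert hf,
        MonoidHom.mul_apply]
      simp only [eq_inv_mul_iff_mul_eq]
    · intro y _ hy
      rw [mul_apply', plaqOp_apply', if_neg hy.symm, zero_mul]
    · exact fun h => absurd (Finset.mem_univ _) h

lemma IsLocal.exists_localObs {A : QuasiLocal G} (hA : IsLocal A) :
    ∃ (L : ℕ) (Λ : Finset Edge) (M : Matrix (Λ → G) (Λ → G) ℂ), Λ ⊆ edgeBox L ∧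
      A = localObs Λ M := by
  obtain ⟨Λ, M, hM⟩ := Set.mem_iUnion.1 hA
  obtain ⟨L, hL⟩ := exists_edgeBox Λ
  exact ⟨L, Λ, M, hL, Subtype.ext hM.symm⟩

/-- A gauge transformation that is constant on a box acts trivially on the edges inside. -/
lemma prod_starShift_eq_one {L M : ℕ} (h : L + 1 ≤ M) (g : G) {e : Edge} (he : e ∈ edgeBox L) :
    (∏ v ∈ starsIn M, starShift v g) e = 1 := by
  have hmem : ∀ v, e ∈ star4 v → v ∈ starsIn M := fun v hv => by
    refine starsIn_mono h ?_
    by_contra h'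
    exact Finset.disjoint_left.1 (star_disjoint h') hv he
  have h1 : Edge.src e ∈ starsIn M := hmem _ (by
    obtain ⟨w, d⟩ := e
    cases d <;> simp [star4, Edge.src])
  have h2 : Edge.tgt e ∈ starsIn M := hmem _ (by
    obtain ⟨w, d⟩ := e
    cases d <;> simp [star4, Edge.tgt])
  rw [Finset.prod_apply]
  simp only [starShift_eq]
  rw [Finset.prod_mul_distrib, Finset.prod_inv_distrib, Finset.prod_ite_eq, Finset.prod_ite_eq,
    if_pos h1, if_pos h2, mul_inv_cancel]

/-- The product of all the monodromies in a box does not depend on the edges inside. -/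
lemma prod_holonomy_eq_one {L M : ℕ} (h : L + 1 ≤ M) {c : Config G}
    (hc : ∀ e, e ∉ edgeBox L → c e = 1) : (∏ f ∈ plaqsIn M, holonomy f) c = 1 := by
  have hmem : ∀ f e, e ∈ plaq4 f → f ∉ plaqsIn M → c e = 1 := fun f e he hf =>
    hc e fun he' => Finset.disjoint_left.1
      (plaq_disjoint fun h' => hf (plaqsIn_mono h h')) he he'
  have key : ∀ (a : ℤ × ℤ) (d : Bool), (∀ f, (f + a, d) ∈ plaq4 f) → (∀ f, (f, d) ∈ plaq4 f) →
      ∏ f ∈ plaqsIn M, c (f + a, d) = ∏ f ∈ plaqsIn M, c (f, d) := by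
    intro a d h1 h2
    have : ∏ f ∈ plaqsIn M, c (f + a, d) =
        ∏ f ∈ (plaqsIn M).map (Equiv.addRight a).toEmbedding, c (f, d) := by
      rw [Finset.prod_map]
      rfl
    rw [this]
    refine Finset.prod_congr_of_eq_on_inter (fun f _ hf => hmem f _ (h2 f) hf) (fun f _ hf => ?_)
      (fun _ _ _ => rfl)
    refine hmem (f - a) _ (by simpa using h1 (f - a)) fun h' => hf ?_
    exact Finset.mem_map.2 ⟨f - a, h', by simp⟩
  rw [MonoidHom.finsetProd_apply]
  simp only [holonomy_apply, Finset.prod_mul_distrib, Finset.prod_inv_distrib]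
  rw [key (0, 1) false (by simp [plaq4]) (by simp [plaq4]),
    key (1, 0) true (by simp [plaq4]) (by simp [plaq4]), mul_inv_cancel_comm, mul_inv_cancel]

lemma isChargeModel_electric :
    IsChargeModel (electricFamily G) (magneticFamily G) starsIn plaqsIn where
  mono := starsIn_monotone
  eventually_mem := eventually_mem_starsIn
  hamiltonian_eq L := (coe_hamiltonian L).symm
  exists_isTransport := exists_isTransport_electric
  isLocal_proj := isLocal_electricProj
  eventually_commute A hA := by
    obtain ⟨L, Λ, M, hΛ, rfl⟩ := hA.exists_localObs
    filter_upwards [eventually_ge_atTop (L + 1)] with N hN χ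
    obtain ⟨W, hW, hE⟩ := coe_electricFamily_total_eq_sum (G := G) (starsIn N)
    rw [hE]
    refine (Commute.sum_left _ _ _ fun g _ => ?_).smul_left _
    refine (commute_localObs_of_apply (k := 1) (a := (∏ v ∈ starsIn N, starShift v g)⁻¹)
      (fun ψ c => ?_) (fun e he => ?_) (fun _ _ => rfl) M).smul_left _
    · rw [hW, Pi.one_apply, one_mul]
    · rw [Pi.inv_apply, prod_starShift_eq_one hN g (hΛ he), inv_one]

lemma isChargeModel_magnetic :
    IsChargeModel (magneticFamily G) (electricFamily G) plaqsIn starsIn where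
  mono := plaqsIn_monotone
  eventually_mem := eventually_mem_plaqsIn
  hamiltonian_eq L := by rw [← coe_hamiltonian, add_comm]
  exists_isTransport := exists_isTransport_magnetic
  isLocal_proj f c := isLocal_localObs _ _
  eventually_commute A hA := by
    obtain ⟨L, Λ, M, hΛ, rfl⟩ := hA.exists_localObs
    filter_upwards [eventually_ge_atTop (L + 1)] with N hN x
    refine commute_localObs_of_apply (a := 1)
      (k := fun c => if (∏ f ∈ plaqsIn N, holonomy f) c = x then 1 else 0)
      (fun ψ c => ?_) (fun e he => rfl) (fun c b => ?_) M
    · rw [coe_magneticFamily_total_apply, one_mul]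
    · have e : (∏ f ∈ plaqsIn N, holonomy f) (glue Λ c b) =
          (∏ f ∈ plaqsIn N, holonomy f) c := by
        rw [← mul_inv_eq_one, ← map_inv, ← map_mul]
        refine prod_holonomy_eq_one hN fun e he => ?_
        have : e ∉ Λ := fun h => he (hΛ h)
        simp [glue, this]
      simp only [e]

open PositiveFunctional

/-! ### Charges in a ground state -/

/-- A functional on the quasi-local algebra, as a linear map. -/
abbrev toLinear (ω : WeakDual ℂ (QuasiLocal G)) : QuasiLocal G →ₗ[ℂ] ℂ :=
  (WeakDual.toStrongDual ω).toLinearMap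

/-- The restriction of a functional to the algebra of charges. -/
def chargeRestrict (ω : WeakDual ℂ (QuasiLocal G)) : chargeAlgebra G →ₗ[ℂ] ℂ :=
  toLinear ω ∘ₗ (chargeAlgebra G).subtype.toAlgHom.toLinearMap

lemma chargeRestrict_apply (ω : WeakDual ℂ (QuasiLocal G)) (A : chargeAlgebra G) :
    chargeRestrict ω A = ω (A : QuasiLocal G) := rfl

lemma IsState.nonneg {ω : WeakDual ℂ (QuasiLocal G)} (h : IsState ω) :
    ∀ A, 0 ≤ toLinear ω (star A * A) := h.1

lemma IsState.chargeRestrict_nonneg {ω : WeakDual ℂ (QuasiLocal G)} (h : IsState ω) :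
    ∀ A, 0 ≤ chargeRestrict ω (star A * A) := fun A => h.1 (A : QuasiLocal G)

/-- Evaluation of the ground state condition: the commutators with the local Hamiltonians may be
replaced by any expression with which they agree eventually. -/
lemma map_star_mul_derivation (ω : WeakDual ℂ (QuasiLocal G)) {A : QuasiLocal G} (hA : IsLocal A)
    {z : ℂ} (h : ∀ᶠ L in atTop,
      ω (star A * (hamiltonian G L * A - A * hamiltonian G L)) = z) :
    ω (star A * derivation A) = z := by
  have h1 := tendsto_derivation hA
  have h2 : Continuous fun B : QuasiLocal G => ω (star A * B) :=
    (WeakDual.toStrongDual ω).continuous.comp (continuous_const.mul continuous_id)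
  have h3 := (h2.tendsto _).comp h1
  exact tendsto_nhds_unique h3 (tendsto_const_nhds.congr' (h.mono fun L hL => hL.symm))

section Model

variable {X Y : Type*} [CommGroup X] [Fintype X] [CommGroup Y] [Fintype Y]
  {D : ChargeFamily (chargeAlgebra G) (ℤ × ℤ) X} {D' : ChargeFamily (chargeAlgebra G) (ℤ × ℤ) Y}
  {S S' : ℕ → Finset (ℤ × ℤ)}

/-- Conjugation by a transport changes the energy at the two ends only. -/
lemma IsTransport.hamiltonian_mul {x : X} {v w : ℤ × ℤ} {U : QuasiLocal G}
    (hU : IsTransport D D' x v w U) (hD : IsChargeModel D D' S S') (L : ℕ) :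
    hamiltonian G L * U = U * ((∑ u ∈ S L, (1 - D.proj u
      ((Pi.mulSingle v x * (Pi.mulSingle w x)⁻¹ : ℤ × ℤ → X) u)) +
        ∑ f ∈ S' L, (1 - D'.proj f 1) : chargeAlgebra G) : QuasiLocal G) := by
  rw [hD.hamiltonian_eq]
  push_cast
  rw [add_mul, mul_add, Finset.sum_mul, Finset.mul_sum, Finset.sum_mul, Finset.mul_sum]
  congr 1
  · refine Finset.sum_congr rfl fun u _ => ?_
    rw [sub_mul, mul_sub, hU.proj_mul, one_mul U, one_mul (_ : X)]
    exact congrArg (· - _) (mul_one U).symm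
  · refine Finset.sum_congr rfl fun f _ => ?_
    exact ((Commute.one_left U).sub_left (hU.commute f 1)).eq

/-- In a ground state no two sites are charged simultaneously: moving one charge on top of the other
by a local unitary would lower the energy. -/
lemma IsChargeModel.map_proj_mul_proj (hD : IsChargeModel D D' S S')
    {ω : WeakDual ℂ (QuasiLocal G)} (hω : ω ∈ groundStates G) {v w : ℤ × ℤ} (hvw : v ≠ w) {x y : X}
    (hx : x ≠ 1) (hy : y ≠ 1) :
    chargeRestrict ω (D.proj v x * D.proj w y) = 0 := by
  classical
  obtain ⟨U, hU⟩ := hD.exists_isTransport x v w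
  obtain ⟨P, hP⟩ : ∃ P : chargeAlgebra G, P = D.proj v x * D.proj w y := ⟨_, rfl⟩
  have hPs : star P = P := by rw [hP, star_mul, D.star_proj, D.star_proj, mul_comm]
  have hPP : P * P = P := by rw [hP, mul_mul_mul_comm, D.proj_mul_self, D.proj_mul_self]
  have hloc : IsLocal (P : QuasiLocal G) := by
    rw [hP]
    exact (hD.isLocal_proj v x).mul (hD.isLocal_proj w y)
  set k : ℂ := if y = x⁻¹ then 2 else 1 with hk
  have key : ω (star (U * (P : QuasiLocal G)) * derivation (U * (P : QuasiLocal G))) =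
      -k * ω (P : QuasiLocal G) := by
    refine map_star_mul_derivation ω (hU.isLocal.mul hloc) ?_
    filter_upwards [hD.eventually_mem v, hD.eventually_mem w] with L hv hw
    have e3 := D.proj_mul_proj_mul_energy hvw hx hy hv hw
    rw [← hP, ← hk] at e3
    have e1 := hU.hamiltonian_mul hD L
    have e0 := hD.hamiltonian_eq L
    generalize (∑ u ∈ S L, (1 - D.proj u
      ((Pi.mulSingle v x * (Pi.mulSingle w x)⁻¹ : ℤ × ℤ → X) u))) = H₁ at e1 e3
    generalize (∑ u ∈ S L, (1 - D.proj u 1)) = H₀ at e0 e3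
    generalize (∑ f ∈ S' L, (1 - D'.proj f 1)) = H' at e0 e1
    have e4 : P * ((H₁ + H') * P - P * (H₀ + H')) = (-k) • P := by
      rw [← e3, mul_comm _ P, ← mul_sub, ← mul_assoc, hPP, add_sub_add_right_eq_sub]
    rw [star_mul_commutator hU.star_mul_self (congrArg Subtype.val hPs) e1, e0]
    refine (congrArg (chargeRestrict ω) e4).trans ?_
    exact (chargeRestrict ω).map_smul (-k) P
  have h1 := hω.2 _ (hU.isLocal.mul hloc)
  rw [key] at h1
  have h2 : 0 ≤ ω (P : QuasiLocal G) :=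
    nonneg_of_projection hω.1.chargeRestrict_nonneg hPs hPP
  have hk0 : 0 < k := by rw [hk]; split_ifs <;> norm_num
  rw [← hP]
  exact eq_zero_of_neg_mul_nonneg hk0 h2 h1

lemma IsChargeModel.map_one_sub_proj_mul (hD : IsChargeModel D D' S S')
    {ω : WeakDual ℂ (QuasiLocal G)} (hω : ω ∈ groundStates G) {v w : ℤ × ℤ} (hvw : v ≠ w) :
    chargeRestrict ω ((1 - D.proj v 1) * (1 - D.proj w 1)) = 0 := by
  classical
  have h : ∀ u, 1 - D.proj u 1 = ∑ x ∈ Finset.univ.erase 1, D.proj u x := fun u => by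
    rw [← D.sum_proj u, ← Finset.add_sum_erase _ _ (Finset.mem_univ 1), add_sub_cancel_left]
  rw [h, h, Finset.sum_mul_sum, map_sum]
  refine Finset.sum_eq_zero fun x hx => ?_
  rw [map_sum]
  exact Finset.sum_eq_zero fun y hy => hD.map_proj_mul_proj hω hvw (Finset.ne_of_mem_erase hx)
    (Finset.ne_of_mem_erase hy)

lemma IsChargeModel.exists_monotone_bound (hD : IsChargeModel D D' S S')
    {ω : WeakDual ℂ (QuasiLocal G)} (hω : ω ∈ groundStates G) :
    ∃ b : ℕ → ℝ, Monotone b ∧ (∀ L, b L ≤ 1) ∧ ∀ L M, L ≤ M → ∀ x,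
      chargeRestrict ω ((D.total (S M) x - D.total (S L) x) ^ 2) ≤ ((b M - b L : ℝ) : ℂ) :=
  D.exists_monotone_bound hω.1.chargeRestrict_nonneg hω.1.2
    (fun _ _ h => hD.map_one_sub_proj_mul hω h) S hD.mono

end Model

/-! ### Limits of the charge components -/

/-- The projection `D_L^{χ,c}` as an element of the algebra of charges. -/
def chargeProj (L : ℕ) (p : Dual G × G) : chargeAlgebra G :=
  (electricFamily G).total (starsIn L) p.1 * (magneticFamily G).total (plaqsIn L) p.2

lemma coe_chargeProj (L : ℕ) (p : Dual G × G) :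
    (chargeProj L p : QuasiLocal G) = globalCharge L p := by
  rw [globalCharge, ← coe_electricFamily_total, ← coe_magneticFamily_total]
  rfl

lemma star_chargeProj (L : ℕ) (p : Dual G × G) : star (chargeProj L p) = chargeProj L p := by
  rw [chargeProj, star_mul, ChargeFamily.star_total, ChargeFamily.star_total, mul_comm]

lemma chargeProj_mul_self (L : ℕ) (p : Dual G × G) :
    chargeProj L p * chargeProj L p = chargeProj L p := by
  rw [chargeProj, mul_mul_mul_comm, ChargeFamily.total_mul_self, ChargeFamily.total_mul_self]

lemma star_globalCharge (L : ℕ) (p : Dual G × G) :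
    star (globalCharge L p) = globalCharge L p := by
  rw [← coe_chargeProj]
  exact congrArg Subtype.val (star_chargeProj L p)

lemma globalCharge_mul_self (L : ℕ) (p : Dual G × G) :
    globalCharge L p * globalCharge L p = globalCharge L p := by
  rw [← coe_chargeProj]
  exact congrArg Subtype.val (chargeProj_mul_self L p)

lemma sum_globalCharge (L : ℕ) : ∑ p : Dual G × G, globalCharge L p = 1 := by
  have h : ∑ p : Dual G × G, chargeProj L p = 1 := by
    rw [Fintype.sum_prod_type]
    simp only [chargeProj]
    rw [← Finset.sum_mul_sum, ChargeFamily.sum_total, ChargeFamily.sum_total, one_mul]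
  have h' := congrArg (Subtype.val : chargeAlgebra G → QuasiLocal G) h
  rw [AddSubmonoidClass.coe_finsetSum] at h'
  simp only [coe_chargeProj] at h'
  exact h'

lemma eventually_commute_globalCharge {A : QuasiLocal G} (hA : IsLocal A) :
    ∀ᶠ L in atTop, ∀ p : Dual G × G, Commute (globalCharge L p) A := by
  filter_upwards [isChargeModel_electric.eventually_commute A hA,
    isChargeModel_magnetic.eventually_commute A hA] with L h1 h2 p
  rw [← coe_chargeProj]
  exact (h1 p.1).mul_left (h2 p.2)

/-- In a ground state, the charge projections form a Cauchy sequence in the seminorm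
`ω(A* A)^(1/2)`. -/
lemma exists_bound_globalCharge {ω : WeakDual ℂ (QuasiLocal G)} (hω : ω ∈ groundStates G) :
    ∃ b : ℕ → ℝ, CauchySeq b ∧ ∀ L M, L ≤ M → ∀ p : Dual G × G,
      (ω (star (globalCharge M p - globalCharge L p) *
        (globalCharge M p - globalCharge L p))).re ≤ b M - b L := by
  obtain ⟨b, hb, hb1, hbE⟩ := isChargeModel_electric.exists_monotone_bound hω
  obtain ⟨b', hb', hb1', hbE'⟩ := isChargeModel_magnetic.exists_monotone_bound hω
  refine ⟨fun L => 2 * (b L + b' L), ?_, fun L M h p => ?_⟩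
  · have h1 := tendsto_atTop_ciSup hb ⟨1, by rintro _ ⟨L, rfl⟩; exact hb1 L⟩
    have h2 := tendsto_atTop_ciSup hb' ⟨1, by rintro _ ⟨L, rfl⟩; exact hb1' L⟩
    exact ((h1.add h2).const_mul 2).cauchySeq
  · have hpos := hω.1.chargeRestrict_nonneg
    have h1 := hbE L M h p.1
    have h2 := hbE' L M h p.2
    have e0 : ω (star (globalCharge M p - globalCharge L p) *
        (globalCharge M p - globalCharge L p)) =
        chargeRestrict ω ((chargeProj M p - chargeProj L p) ^ 2) := by
      rw [chargeRestrict_apply, ← coe_chargeProj, ← coe_chargeProj]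
      have : (chargeProj M p - chargeProj L p) ^ 2 =
          star (chargeProj M p - chargeProj L p) * (chargeProj M p - chargeProj L p) := by
        rw [star_sub, star_chargeProj, star_chargeProj, sq]
      rw [this]
      rfl
    rw [e0]
    have h3 := map_mul_sub_mul_sq_le hpos ((electricFamily G).star_total (starsIn M) p.1)
      ((electricFamily G).star_total (starsIn L) p.1)
      ((magneticFamily G).star_total (plaqsIn M) p.2)
      ((magneticFamily G).star_total (plaqsIn L) p.2)
      ((electricFamily G).total_mul_self (starsIn M) p.1)
      ((magneticFamily G).total_mul_self (plaqsIn L) p.2)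
    refine h3.trans ?_
    have r1 := (Complex.le_def.1 h1).1
    have r2 := (Complex.le_def.1 h2).1
    rw [Complex.ofReal_re] at r1 r2
    linarith

/-- For a ground state `ω` the functionals `ω( · D_L^{χ,c})` converge in the weak* topology. -/
lemma exists_tendsto_rightMul {ω : WeakDual ℂ (QuasiLocal G)} (hω : ω ∈ groundStates G)
    (p : Dual G × G) :
    ∃ Φ : WeakDual ℂ (QuasiLocal G),
      ∀ A, Tendsto (fun L => ω (A * globalCharge L p)) atTop (𝓝 (Φ A)) := by
  obtain ⟨b, hb, hbD⟩ := exists_bound_globalCharge hω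
  exact exists_tendsto_mul_right hω.1.1 hω.1.2 hb fun L M h => hbD L M h p

/-- The local observables are dense. -/
lemma dense_isLocal : Dense {A : QuasiLocal G | IsLocal A} := by
  refine Subtype.dense_iff.2 fun A hA => ?_
  have h : (localAlgebra G : Set (Hilb G →L[ℂ] Hilb G)) ⊆
      Subtype.val '' {A : QuasiLocal G | IsLocal A} :=
    fun B hB => ⟨⟨B, (localAlgebra G).le_topologicalClosure hB⟩, hB, rfl⟩
  exact closure_mono h hA

/-- The limit of `ω( · D_L^{χ,c})` is positive, since `D_L^{χ,c}` commutes with any given local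
observable for large `L`. -/
lemma nonneg_of_tendsto_rightMul {ω Φ : WeakDual ℂ (QuasiLocal G)} (hω : IsState ω)
    {p : Dual G × G} (hΦ : ∀ A, Tendsto (fun L => ω (A * globalCharge L p)) atTop (𝓝 (Φ A)))
    (A : QuasiLocal G) : 0 ≤ Φ (star A * A) := by
  refine (isClosed_nonneg Φ).closure_subset_iff.2 (fun A hA => ?_) (dense_isLocal A)
  refine ge_of_tendsto (hΦ _) ?_
  filter_upwards [eventually_commute_globalCharge hA] with L hL
  rw [star_mul_self_mul_projection (star_globalCharge L p) (globalCharge_mul_self L p) (hL p)]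
  exact hω.1 _

/-! ### Ground states of prescribed charge -/

/-- The functional `A ↦ ⟨ψ, A ψ⟩`. -/
def vectorState (ψ : Hilb G) : WeakDual ℂ (QuasiLocal G) :=
  StrongDual.toWeakDual (LinearMap.mkContinuous
    { toFun := fun A => inner ℂ ψ ((A : Hilb G →L[ℂ] Hilb G) ψ)
      map_add' := fun A B => inner_add_right _ _ _
      map_smul' := fun z A => inner_smul_right _ _ _ } (‖ψ‖ * ‖ψ‖) (fun A =>
        (norm_inner_le_norm _ _).trans (by
          have h := (A : Hilb G →L[ℂ] Hilb G).le_opNorm ψ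
          calc ‖ψ‖ * ‖(A : Hilb G →L[ℂ] Hilb G) ψ‖ ≤ ‖ψ‖ * (‖A‖ * ‖ψ‖) := by gcongr; exact h
            _ = ‖ψ‖ * ‖ψ‖ * ‖A‖ := by ring)))

lemma vectorState_apply (ψ : Hilb G) (A : QuasiLocal G) :
    vectorState ψ A = inner ℂ ψ ((A : Hilb G →L[ℂ] Hilb G) ψ) := rfl

lemma norm_vectorState_le {ψ : Hilb G} (hψ : ‖ψ‖ = 1) (A : QuasiLocal G) :
    ‖vectorState ψ A‖ ≤ ‖A‖ := by
  have h := (A : Hilb G →L[ℂ] Hilb G).le_opNorm ψ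
  rw [hψ, mul_one] at h
  have h2 := norm_inner_le_norm (𝕜 := ℂ) ψ ((A : Hilb G →L[ℂ] Hilb G) ψ)
  rw [hψ, one_mul] at h2
  exact h2.trans h

lemma isState_vectorState {ψ : Hilb G} (hψ : ‖ψ‖ = 1) : IsState (vectorState ψ) := by
  refine ⟨fun A => ?_, ?_⟩
  · have h : vectorState ψ (star A * A) = inner ℂ ((A : Hilb G →L[ℂ] Hilb G) ψ)
        ((A : Hilb G →L[ℂ] Hilb G) ψ) := by
      change inner ℂ ψ (star (A : Hilb G →L[ℂ] Hilb G) ((A : Hilb G →L[ℂ] Hilb G) ψ)) = _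
      rw [ContinuousLinearMap.star_eq_adjoint, ContinuousLinearMap.adjoint_inner_right]
    rw [h, inner_self_eq_norm_sq_to_K]
    norm_cast
    exact Complex.zero_le_real.2 (sq_nonneg _)
  · change inner ℂ ψ ψ = 1
    rw [inner_self_eq_norm_sq_to_K, hψ]
    simp

section Model

variable {X Y : Type*} [CommGroup X] [Fintype X] [CommGroup Y] [Fintype Y]
  {D : ChargeFamily (chargeAlgebra G) (ℤ × ℤ) X} {D' : ChargeFamily (chargeAlgebra G) (ℤ × ℤ) Y}
  {S S' : ℕ → Finset (ℤ × ℤ)}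

/-- Charges can be prescribed on any finite set of sites, without affecting those of the other kind.
At each new site the vector is projected on some charge, and the excess of charge is then
transported to a site outside the set. -/
lemma IsChargeModel.exists_vector (hD : IsChargeModel D D' S S') (κ : ℤ × ℤ → X) (κ' : ℤ × ℤ → Y)
    (T T' : Finset (ℤ × ℤ)) {ψ : Hilb G} (hψ : ‖ψ‖ = 1)
    (hψ' : ∀ f ∈ T', ((D'.proj f (κ' f) : QuasiLocal G) : Hilb G →L[ℂ] Hilb G) ψ = ψ) :
    ∃ φ : Hilb G, ‖φ‖ = 1 ∧
      (∀ v ∈ T, ((D.proj v (κ v) : QuasiLocal G) : Hilb G →L[ℂ] Hilb G) φ = φ) ∧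
      ∀ f ∈ T', ((D'.proj f (κ' f) : QuasiLocal G) : Hilb G →L[ℂ] Hilb G) φ = φ := by
  classical
  induction T using Finset.induction_on with
  | empty => exact ⟨ψ, hψ, by simp, hψ'⟩
  | insert v T hv ih =>
    obtain ⟨φ, hφ, h1, h2⟩ := ih
    have act_mul : ∀ (A B : QuasiLocal G) (η : Hilb G), (A : Hilb G →L[ℂ] Hilb G)
        ((B : Hilb G →L[ℂ] Hilb G) η) = ((A * B : QuasiLocal G) : Hilb G →L[ℂ] Hilb G) η :=
      fun A B η => rfl
    obtain ⟨x, hx⟩ : ∃ x, ((D.proj v x : QuasiLocal G) : Hilb G →L[ℂ] Hilb G) φ ≠ 0 := by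
      by_contra! h
      have e : φ = ∑ x, ((D.proj v x : QuasiLocal G) : Hilb G →L[ℂ] Hilb G) φ := by
        have e1 := congrArg (fun A : chargeAlgebra G =>
          ((A : QuasiLocal G) : Hilb G →L[ℂ] Hilb G) φ) (D.sum_proj v)
        simp only [AddSubmonoidClass.coe_finsetSum, _root_.sum_apply] at e1
        exact e1.symm
      rw [Finset.sum_eq_zero fun x _ => h x] at e
      rw [e, norm_zero] at hφ
      exact zero_ne_one hφ
    obtain ⟨w, hw⟩ := Infinite.exists_notMem_finset (insert v T)
    obtain ⟨U, hU⟩ := hD.exists_isTransport ((κ v)⁻¹ * x) v w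
    set η := ((D.proj v x : QuasiLocal G) : Hilb G →L[ℂ] Hilb G) φ with hη
    set ξ := (U : Hilb G →L[ℂ] Hilb G) η with hξ
    have hξ0 : ξ ≠ 0 := by
      intro h
      have e := congrArg ((star U : QuasiLocal G) : Hilb G →L[ℂ] Hilb G) h
      rw [hξ, act_mul, hU.star_mul_self, map_zero] at e
      exact hx e
    have hDv : ((D.proj v (κ v) : QuasiLocal G) : Hilb G →L[ℂ] Hilb G) ξ = ξ := by
      have hvw : v ≠ w := fun h => hw (by simp [h])
      rw [hξ, act_mul, hU.proj_mul, ← act_mul]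
      have : κ v * (Pi.mulSingle v ((κ v)⁻¹ * x) * (Pi.mulSingle w ((κ v)⁻¹ * x))⁻¹ :
          ℤ × ℤ → X) v = x := by
        simp [hvw]
      rw [this, hη, act_mul (D.proj v x : QuasiLocal G)]
      exact congrArg (fun A : chargeAlgebra G => (U : Hilb G →L[ℂ] Hilb G)
        (((A : QuasiLocal G) : Hilb G →L[ℂ] Hilb G) φ)) (D.proj_mul_self v x)
    have hcomm : ∀ A : chargeAlgebra G, ((A : QuasiLocal G) : Hilb G →L[ℂ] Hilb G) φ = φ →
        ((A : QuasiLocal G) : Hilb G →L[ℂ] Hilb G) η = η := by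
      intro A hA
      have e := congrArg (fun A : chargeAlgebra G =>
        ((A : QuasiLocal G) : Hilb G →L[ℂ] Hilb G) φ) (mul_comm A (D.proj v x))
      refine Eq.trans (b := ((D.proj v x : QuasiLocal G) : Hilb G →L[ℂ] Hilb G)
        (((A : QuasiLocal G) : Hilb G →L[ℂ] Hilb G) φ)) e ?_
      rw [hA]
    have hDT : ∀ u ∈ T, ((D.proj u (κ u) : QuasiLocal G) : Hilb G →L[ℂ] Hilb G) ξ = ξ := by
      intro u hu
      have huw : u ≠ w := fun h => hw (by simp [← h, hu])
      have huv : u ≠ v := fun h => hv (h ▸ hu)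
      rw [hξ, act_mul, hU.proj_mul, ← act_mul]
      have : κ u * (Pi.mulSingle v ((κ v)⁻¹ * x) * (Pi.mulSingle w ((κ v)⁻¹ * x))⁻¹ :
          ℤ × ℤ → X) u = κ u := by
        simp [huw, huv]
      rw [this, hcomm _ (h1 u hu)]
    have hDT' : ∀ f ∈ T', ((D'.proj f (κ' f) : QuasiLocal G) : Hilb G →L[ℂ] Hilb G) ξ = ξ := by
      intro f hf
      rw [hξ, act_mul, (hU.commute f (κ' f)).eq, ← act_mul, hcomm _ (h2 f hf)]
    refine ⟨((‖ξ‖⁻¹ : ℝ) : ℂ) • ξ, ?_, fun u hu => ?_, fun f hf => ?_⟩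
    · rw [norm_smul, Complex.norm_real, norm_inv, norm_norm,
        inv_mul_cancel₀ (norm_ne_zero_iff.2 hξ0)]
    · rw [map_smul]
      congr 1
      rcases Finset.mem_insert.1 hu with rfl | hu
      · exact hDv
      · exact hDT u hu
    · rw [map_smul, hDT' f hf]

variable {ω : WeakDual ℂ (QuasiLocal G)}

/-- In a state with prescribed charges, the other charges have probability zero. -/
lemma map_mul_proj (hω : IsState ω) {v : ℤ × ℤ} {x : X} (h : ω (D.proj v x : QuasiLocal G) = 1)
    (A : QuasiLocal G) (y : X) [Decidable (y = x)] :
    ω (A * (D.proj v y : QuasiLocal G)) = if y = x then ω A else 0 := by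
  have hP := mul_of_map_eq_one hω.nonneg hω.2 (P := (D.proj v x : QuasiLocal G))
    (congrArg Subtype.val (D.star_proj v x)) (congrArg Subtype.val (D.proj_mul_self v x)) h
  split_ifs with hy
  · rw [hy]
    exact hP A
  · have e : (D.proj v y : QuasiLocal G) * (D.proj v x : QuasiLocal G) = 0 :=
      congrArg Subtype.val (D.proj_mul_of_ne v y x hy)
    refine (hP (A * (D.proj v y : QuasiLocal G))).symm.trans ?_
    rw [mul_assoc, e, mul_zero, map_zero]

variable (ω) in
/-- The functional `Y ↦ ω(A* Y A)` on the algebra of charges. -/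
def sandwich (A : QuasiLocal G) : chargeAlgebra G →ₗ[ℂ] ℂ :=
  toLinear ω ∘ₗ LinearMap.mulLeft ℂ (star A) ∘ₗ LinearMap.mulRight ℂ A ∘ₗ
    (chargeAlgebra G).subtype.toAlgHom.toLinearMap

lemma sandwich_apply (A : QuasiLocal G) (Y : chargeAlgebra G) :
    sandwich ω A Y = ω (star A * ((Y : QuasiLocal G) * A)) := rfl

lemma sandwich_nonneg (hω : IsState ω) (A : QuasiLocal G) (Y : chargeAlgebra G) :
    0 ≤ sandwich ω A (star Y * Y) := by
  have h := hω.1 ((Y : QuasiLocal G) * A)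
  rw [star_mul, mul_assoc, ← mul_assoc (star (Y : QuasiLocal G))] at h
  exact h

/-- In a state with a single charge `x`, at the origin, a local operation cannot decrease the number
of charges, because it does not change the total charge of a large box. -/
lemma IsChargeModel.eventually_energy_le (hD : IsChargeModel D D' S S') (hω : IsState ω) {x : X}
    (h : ∀ v, ω (D.proj v ((Pi.mulSingle 0 x : ℤ × ℤ → X) v) : QuasiLocal G) = 1)
    {A : QuasiLocal G} (hA : IsLocal A) : ∀ᶠ L in atTop,
      ω (star A * A * ((∑ v ∈ S L, (1 - D.proj v 1) : chargeAlgebra G) : QuasiLocal G)) ≤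
        sandwich ω A (∑ v ∈ S L, (1 - D.proj v 1)) := by
  classical
  filter_upwards [hD.eventually_mem 0, hD.eventually_commute A hA] with L h0 hL
  have e1 : ω (star A * A * ((∑ v ∈ S L, (1 - D.proj v 1) : chargeAlgebra G) : QuasiLocal G)) =
      if x = 1 then 0 else ω (star A * A) := by
    have e2 : ∀ v, ω (star A * A * ((1 - D.proj v 1 : chargeAlgebra G) : QuasiLocal G)) =
        if v = 0 then (if x = 1 then 0 else ω (star A * A)) else 0 := by
      intro v
      have e3 := map_mul_proj hω (h v) (star A * A) 1
      have e4 : star A * A * ((1 - D.proj v 1 : chargeAlgebra G) : QuasiLocal G) =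
          star A * A - star A * A * (D.proj v 1 : QuasiLocal G) := by
        refine (mul_sub (star A * A) 1 (D.proj v 1 : QuasiLocal G)).trans ?_
        rw [mul_one]
      rw [e4, map_sub, e3]
      by_cases hv : v = 0
      · subst hv
        rw [Pi.mulSingle_eq_same, if_pos rfl]
        by_cases hx : x = 1
        · rw [if_pos hx.symm, if_pos hx, sub_self]
        · rw [if_neg (Ne.symm hx), if_neg hx, sub_zero]
      · rw [Pi.mulSingle_eq_of_ne hv, if_pos rfl, if_neg hv, sub_self]
    rw [AddSubmonoidClass.coe_finsetSum, Finset.mul_sum, map_sum, Finset.sum_congr rfl fun v _ => e2 v,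
      Finset.sum_ite_eq', if_pos h0]
  rw [e1, map_sum]
  split_ifs with hx
  · refine Finset.sum_nonneg fun v _ => ?_
    refine nonneg_of_projection (sandwich_nonneg hω A) ?_ ?_
    · rw [star_sub, star_one, D.star_proj]
    · have := D.proj_mul_self v 1
      linear_combination this
  · have hE : chargeRestrict ω (D.total (S L) x) = 1 := by
      have := D.map_total_eq_one hω.chargeRestrict_nonneg hω.2 h (S L)
      rwa [Finset.prod_pi_mulSingle', if_pos h0] at this
    have hE' := mul_of_map_eq_one hω.nonneg hω.2 (P := (D.total (S L) x : QuasiLocal G))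
      (congrArg Subtype.val (D.star_total (S L) x))
      (congrArg Subtype.val (D.total_mul_self (S L) x)) hE
    have h1 : sandwich ω A 1 = ω (star A * A) := by
      rw [sandwich_apply]
      exact congrArg (fun B => ω (star A * B)) (one_mul A)
    rw [← h1]
    refine D.map_one_le_sum (sandwich_nonneg hω A) hx fun Y => ?_
    rw [sandwich_apply, sandwich_apply]
    have e5 : star A * ((Y * D.total (S L) x : chargeAlgebra G) : QuasiLocal G) * A =
        star A * ((Y : QuasiLocal G) * A) * (D.total (S L) x : QuasiLocal G) := by
      rw [mul_assoc, mul_assoc (star A), mul_assoc (Y : QuasiLocal G), ← (hL x).eq, ← mul_assoc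
        (Y : QuasiLocal G)]
      rfl
    rw [← mul_assoc, e5]
    exact hE' _

end Model

/-- The state with charge `χ` at the origin, flux `c` at the face of the origin and no other
charges is a ground state. -/
lemma mem_groundStates_of_map_proj_eq_one {ω : WeakDual ℂ (QuasiLocal G)} (hω : IsState ω)
    {χ : Dual G} {c : G}
    (h : ∀ v, ω ((electricFamily G).proj v ((Pi.mulSingle 0 χ : ℤ × ℤ → Dual G) v) :
      QuasiLocal G) = 1)
    (h' : ∀ f, ω ((magneticFamily G).proj f ((Pi.mulSingle 0 c : ℤ × ℤ → G) f) :
      QuasiLocal G) = 1) :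
    ω ∈ groundStates G := by
  refine ⟨hω, fun A hA => ?_⟩
  have h2 : Continuous fun B : QuasiLocal G => ω (star A * B) :=
    (WeakDual.toStrongDual ω).continuous.comp (continuous_const.mul continuous_id)
  refine ge_of_tendsto ((h2.tendsto _).comp (tendsto_derivation hA)) ?_
  filter_upwards [isChargeModel_electric.eventually_energy_le hω h hA,
    isChargeModel_magnetic.eventually_energy_le hω h' hA] with L h3 h4
  have e := isChargeModel_electric.hamiltonian_eq (G := G) L
  rw [Function.comp_apply, mul_sub, map_sub, sub_nonneg, e, ← mul_assoc]
  refine le_trans (le_of_eq ?_) ((add_le_add h3 h4).trans (le_of_eq ?_))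
  · rw [← map_add, ← mul_add]
    rfl
  · rw [← map_add]
    rfl

/-- Unit vectors that have prescribed charges in the boxes `Λ_L`. -/
lemma exists_vector_box (κ : ℤ × ℤ → Dual G) (κ' : ℤ × ℤ → G) (L : ℕ) : ∃ ψ : Hilb G, ‖ψ‖ = 1 ∧
    (∀ v ∈ starsIn L, (((electricFamily G).proj v (κ v) : QuasiLocal G) :
      Hilb G →L[ℂ] Hilb G) ψ = ψ) ∧
    ∀ f ∈ plaqsIn L, (((magneticFamily G).proj f (κ' f) : QuasiLocal G) :
      Hilb G →L[ℂ] Hilb G) ψ = ψ := by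
  classical
  have h1 : ‖(lp.single 2 (1 : Config G) (1 : ℂ) : Hilb G)‖ = 1 := by
    rw [lp.norm_single (by norm_num), norm_one]
  obtain ⟨φ, hφ, hφ', -⟩ := isChargeModel_magnetic.exists_vector κ' κ (plaqsIn L) ∅ h1
    (fun f hf => absurd hf (Finset.notMem_empty f))
  exact isChargeModel_electric.exists_vector κ κ' (starsIn L) (plaqsIn L) hφ hφ'

/-- Unit vectors that are eventually fixed by an observable give, in the weak* limit, a state in
which this observable has the expectation `1`. -/
lemma exists_isState_of_vectors {ψ : ℕ → Hilb G} (hψ : ∀ L, ‖ψ L‖ = 1) :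
    ∃ ω : WeakDual ℂ (QuasiLocal G), IsState ω ∧ ∀ B : QuasiLocal G,
      (∀ᶠ L in atTop, (B : Hilb G →L[ℂ] Hilb G) (ψ L) = ψ L) → ω B = 1 := by
  let g : ℕ → WeakDual ℂ (QuasiLocal G) := fun L => vectorState (ψ L)
  have hg : ∀ L A, ‖g L A‖ ≤ ‖A‖ := fun L => norm_vectorState_le (hψ L)
  obtain ⟨ω, hlim⟩ := exists_tendsto_hyperfilter g hg
  have h1 : ∀ L, vectorState (ψ L) 1 = 1 := fun L => (isState_vectorState (hψ L)).2
  refine ⟨ω, ⟨fun A => ?_, ?_⟩, fun B hB => ?_⟩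
  · exact ge_of_tendsto (hlim _) (Eventually.of_forall fun L => (isState_vectorState (hψ L)).1 A)
  · exact tendsto_nhds_unique (hlim 1) (tendsto_const_nhds.congr fun L => (h1 L).symm)
  · refine tendsto_nhds_unique (hlim B) (tendsto_const_nhds.congr' ?_)
    filter_upwards [Nat.hyperfilter_le_atTop hB] with L hL
    rw [vectorState_apply, hL]
    exact (h1 L).symm

lemma map_globalCharge_eq_one {ω : WeakDual ℂ (QuasiLocal G)} (hω : IsState ω)
    {κ : ℤ × ℤ → Dual G} {κ' : ℤ × ℤ → G}
    (h : ∀ v, ω ((electricFamily G).proj v (κ v) : QuasiLocal G) = 1)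
    (h' : ∀ f, ω ((magneticFamily G).proj f (κ' f) : QuasiLocal G) = 1) (L : ℕ) :
    ω (globalCharge L (∏ v ∈ starsIn L, κ v, ∏ f ∈ plaqsIn L, κ' f)) = 1 := by
  have e1 := (electricFamily G).map_total_eq_one hω.chargeRestrict_nonneg hω.2 h (starsIn L)
  have e2 := (magneticFamily G).map_total_eq_one hω.chargeRestrict_nonneg hω.2 h' (plaqsIn L)
  rw [← coe_chargeProj, ← chargeRestrict_apply, chargeProj]
  rw [mul_of_map_eq_one hω.chargeRestrict_nonneg hω.2 (ChargeFamily.star_total _ _ _)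
    (ChargeFamily.total_mul_self _ _ _) e2, e1]

/-- There is a ground state of charge `(χ, c)`: a weak* limit point of vector states with charge
`χ` and flux `c` at the origin and no other charges in a large box. -/
lemma exists_groundState_map_globalCharge (p : Dual G × G) :
    ∃ ω ∈ groundStates G, ∀ᶠ L in atTop, ω (globalCharge L p) = 1 := by
  classical
  choose ψ hψ hψE hψM using exists_vector_box (Pi.mulSingle 0 p.1 : ℤ × ℤ → Dual G)
    (Pi.mulSingle 0 p.2 : ℤ × ℤ → G)
  obtain ⟨ω, hω, hfix⟩ := exists_isState_of_vectors hψ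
  have hE : ∀ v, ω ((electricFamily G).proj v ((Pi.mulSingle 0 p.1 : ℤ × ℤ → Dual G) v) :
      QuasiLocal G) = 1 := fun v =>
    hfix _ ((eventually_mem_starsIn v).mono fun L hL => hψE L v hL)
  have hM : ∀ f, ω ((magneticFamily G).proj f ((Pi.mulSingle 0 p.2 : ℤ × ℤ → G) f) :
      QuasiLocal G) = 1 := fun f =>
    hfix _ ((eventually_mem_plaqsIn f).mono fun L hL => hψM L f hL)
  refine ⟨ω, mem_groundStates_of_map_proj_eq_one hω hE hM, ?_⟩
  filter_upwards [eventually_mem_starsIn 0, eventually_mem_plaqsIn 0] with L h1 h2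
  have e := map_globalCharge_eq_one hω hE hM L
  rwa [Finset.prod_pi_mulSingle', Finset.prod_pi_mulSingle', if_pos h1, if_pos h2] at e

/-! ### The decomposition -/

section Decomposition

variable {ω Φ : WeakDual ℂ (QuasiLocal G)} {p : Dual G × G}

lemma tendsto_globalCharge
    (hΦ : ∀ A, Tendsto (fun L => ω (A * globalCharge L p)) atTop (𝓝 (Φ A))) :
    Tendsto (fun L => ω (globalCharge L p)) atTop (𝓝 (Φ 1)) := by
  simpa only [one_mul] using hΦ 1

lemma tendsto_chargeComponent
    (hΦ : ∀ A, Tendsto (fun L => ω (A * globalCharge L p)) atTop (𝓝 (Φ A))) (h : Φ 1 ≠ 0) :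
    Tendsto (fun L => chargeComponent ω p L) atTop (𝓝 ((Φ 1)⁻¹ • Φ)) := by
  rw [tendsto_iff_forall_eval_tendsto_topDualPairing]
  intro A
  exact ((tendsto_globalCharge hΦ).inv₀ h).mul (hΦ A)

lemma mem_chargedStates (hω : ω ∈ groundStates G)
    (hΦ : ∀ A, Tendsto (fun L => ω (A * globalCharge L p)) atTop (𝓝 (Φ A))) (h : 0 < Φ 1) :
    (Φ 1)⁻¹ • Φ ∈ chargedStates p := by
  have hre : ((Φ 1).re : ℂ) = Φ 1 := (Complex.eq_re_of_ofReal_le h.le).symm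
  refine ⟨⟨fun A => ?_, ?_⟩, ω, hω, ⟨(Φ 1).re, (Complex.lt_def.1 h).1, ?_⟩,
    tendsto_chargeComponent hΦ h.ne'⟩
  · exact mul_nonneg (inv_nonneg.2 h.le) (nonneg_of_tendsto_rightMul hω.1 hΦ A)
  · exact inv_mul_cancel₀ h.ne'
  · rw [hre]
    exact tendsto_globalCharge hΦ

/-- A charge component of weight zero vanishes, by the Cauchy-Schwarz inequality. -/
lemma eq_zero_of_map_one_eq_zero (hω : IsState ω)
    (hΦ : ∀ A, Tendsto (fun L => ω (A * globalCharge L p)) atTop (𝓝 (Φ A))) (h : Φ 1 = 0)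
    (A : QuasiLocal G) : Φ A = 0 := by
  have h1 : ∀ L, ‖ω (A * globalCharge L p)‖ ^ 2 ≤
      (ω (A * star A)).re * (ω (globalCharge L p)).re := by
    intro L
    have := cauchy_schwarz hω.nonneg hω.2 A (globalCharge L p)
    rwa [star_globalCharge, globalCharge_mul_self] at this
  have h2 : Tendsto (fun L => (ω (A * star A)).re * (ω (globalCharge L p)).re) atTop (𝓝 0) := by
    have h3 := (Complex.continuous_re.tendsto _).comp (tendsto_globalCharge hΦ)
    rw [h, Complex.zero_re] at h3
    simpa using h3.const_mul (ω (A * star A)).re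
  have h4 : ‖Φ A‖ ^ 2 ≤ 0 := le_of_tendsto_of_tendsto' ((hΦ A).norm.pow 2) h2 h1
  exact norm_eq_zero.1 ((pow_eq_zero_iff two_ne_zero).1 (le_antisymm h4 (by positivity)))

lemma chargedStates_nonempty (p : Dual G × G) : (chargedStates p).Nonempty := by
  obtain ⟨ω, hω, h⟩ := exists_groundState_map_globalCharge p
  obtain ⟨Φ, hΦ⟩ := exists_tendsto_rightMul hω p
  have h1 : Φ 1 = 1 := tendsto_nhds_unique (tendsto_globalCharge hΦ)
    (tendsto_const_nhds.congr' (h.mono fun L hL => hL.symm))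
  exact ⟨_, mem_chargedStates hω hΦ (by rw [h1]; exact zero_lt_one)⟩

end Decomposition

end QuantumDouble

end

theorem mainTheorem1 {G : Type*} [CommGroup G] [Fintype G] [DecidableEq G]
    (ω : WeakDual ℂ (QuantumDouble.QuasiLocal G)) (hω : ω ∈ QuantumDouble.groundStates G) :
    ∃ (lam : QuantumDouble.Dual G × G → ℝ)
      (ω' : QuantumDouble.Dual G × G → WeakDual ℂ (QuantumDouble.QuasiLocal G)),
      (∀ p, 0 ≤ lam p) ∧ ∑ p, lam p = 1 ∧
      (∀ p, ω' p ∈ QuantumDouble.chargedStates p) ∧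
      ω = ∑ p, (lam p : ℂ) • ω' p ∧
      (∀ p, Tendsto (fun L => ω (QuantumDouble.globalCharge L p)) atTop (𝓝 (lam p : ℂ))) ∧
      (∀ p, 0 < lam p →
        Tendsto (fun L => QuantumDouble.chargeComponent ω p L) atTop (𝓝 (ω' p))) := by
  classical
  choose Φ hΦ using QuantumDouble.exists_tendsto_rightMul hω
  choose φ hφ using QuantumDouble.chargedStates_nonempty (G := G)
  have hpos : ∀ p, 0 ≤ Φ p 1 := fun p => by
    have := QuantumDouble.nonneg_of_tendsto_rightMul hω.1 (hΦ p) 1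
    rwa [star_one, one_mul] at this
  have hre : ∀ p, ((Φ p 1).re : ℂ) = Φ p 1 := fun p =>
    (Complex.eq_re_of_ofReal_le (hpos p)).symm
  have hlt : ∀ p, 0 < (Φ p 1).re → 0 < Φ p 1 := fun p h => by
    rw [← hre]
    exact_mod_cast h
  have hsum : ∀ A, ∑ p, Φ p A = ω A := by
    intro A
    refine tendsto_nhds_unique (tendsto_finsetSum _ fun p _ => hΦ p A)
      (tendsto_const_nhds.congr fun L => ?_)
    rw [← map_sum, ← Finset.mul_sum, QuantumDouble.sum_globalCharge, mul_one]
  -- components of weight zero are filled with arbitrary charged states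
  refine ⟨fun p => (Φ p 1).re, fun p => if 0 < (Φ p 1).re then (Φ p 1)⁻¹ • Φ p else φ p,
    fun p => (Complex.nonneg_iff.1 (hpos p)).1, ?_, fun p => ?_, ?_, fun p => ?_, fun p hp => ?_⟩
  · have h1 := hsum 1
    rw [hω.1.2] at h1
    rw [← Complex.re_sum, h1, Complex.one_re]
  · beta_reduce
    split_ifs with hp
    · exact QuantumDouble.mem_chargedStates hω (hΦ p) (hlt p hp)
    · exact hφ p
  · have hterm : ∀ p, ((Φ p 1).re : ℂ) •
        (if 0 < (Φ p 1).re then (Φ p 1)⁻¹ • Φ p else φ p) = Φ p := by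
      intro p
      split_ifs with hp
      · rw [hre, smul_inv_smul₀ (hlt p hp).ne']
      · have h0 : (Φ p 1).re = 0 :=
          le_antisymm (not_lt.1 hp) (Complex.nonneg_iff.1 (hpos p)).1
        have h1 : Φ p 1 = 0 := by rw [← hre, h0, Complex.ofReal_zero]
        rw [h0, Complex.ofReal_zero, zero_smul]
        exact (DFunLike.ext _ _ (QuantumDouble.eq_zero_of_map_one_eq_zero hω.1 (hΦ p) h1)).symm
    rw [Finset.sum_congr rfl fun p _ => hterm p]
    refine DFunLike.ext _ _ fun A => (hsum A).symm.trans ?_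
    exact (map_sum (LinearMap.flip (topDualPairing ℂ (QuantumDouble.QuasiLocal G)) A)
      Φ Finset.univ).symm
  · rw [hre]
    exact QuantumDouble.tendsto_globalCharge (hΦ p)
  · beta_reduce at hp ⊢
    rw [if_pos hp]
    exact QuantumDouble.tendsto_chargeComponent (hΦ p) (hlt p hp).ne'
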